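/- Let $\mathbb K\in\{\mathbb R,\mathbb C\}$, let $m\ge 1$, $n\ge 0$ and $0\le l\le m$ be integers, $\Phi\in\mathbb K^{m\times n}$ a fixed matrix with columns $\phi_1,\dots,\phi_n$, and $X_0\in\mathbb K^{n\times l}$ a fixed matrix with set of nonzero row indices $\Omega=\operatorname{supp}(X_0)$. Write $X_0^{\{a\}}$ for its $a$-th row, $\Phi_J$ for the submatrix of the columns indexed by $J$, $\mathcal R(\Phi_J)$ for its column space, $\Phi_J^\dagger$ for its Moore–Penrose pseudoinverse, $\sigma_{|J|}(\Phi_J)$ for its $|J|$-th largest singular value, and $P_S$, $P_S^\perp$ for the orthogonal projections onto a subspace $S$ of $\mathbb K^m$ and onto its orthogonal complement. Let $\sigma>0$, let $W\in\mathbb R^{m\times l}$ be a random matrix with i.i.d. $N(0,\sigma^2)$ entries, and let $Y=\Phi X_0+W$. For $J\subseteq\{1,\dots,n\}$ put $$c(\kappa,\sigma,X_0,J)=\frac{\kappa\,\sigma_{|J|}(\Phi_J)}{2\sigma}-\sqrt{|J|}-1 .$$ The algorithms TSMP$_1(k)$ and TSMP$_2(\kappa)$, with input $(Y,\Phi)$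 and output $(\Omega_c,\hat\Omega,\hat X)$, are as follows. 1. Compute a subspace $\hat S\subseteq\mathbb K^m$ from $Y$ by an arbitrary subspace estimator. 2. Starting from $\Gamma=\emptyset$, repeat $m-1$ times: add to $\Gamma$ an index $j\notin\Gamma$ that maximizes $\|P_{T}\phi_j\|_2/\|P^{\perp}_{\mathcal R(\Phi_\Gamma)}\phi_j\|_2$ over all $j\notin\Gamma$, where $T=P^\perp_{\mathcal R(\Phi_\Gamma)}\hat S$ and $0/0=0$. Put $\Omega_c=\Gamma$. 3. For $j\in\Omega_c$ let $\zeta_j$ be the Euclidean norm of the row of $\Phi_{\Omega_c}^\dagger Y$ with index $j$. TSMP$_1(k)$ lets $\hat\Omega$ be the set of indices of the $k$ largest $\zeta_j$ (all of $\Omega_c$ if $k>|\Omega_c|$), and TSMP$_2(\kappa)$ lets $\hat\Omega=\{j\in\Omega_c:\zeta_j>\kappa\}$. The rows of $\hat X$ indexed by $\hat\Omega$ are those of $\Phi_{\hat\Omega}^\dagger Y$; the other rows are zero. Ties are broken arbitrarily. **Claim.** Let $0<2\kappa\le\|X_0^{\{a\}}\|_2$ for all $a\in\Omega$. Then for every constant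 $c>0$ there is an event of probability greater than $1-m\exp(-c^2/2)$ on which every output of TSMP$_1(|\Omega|)$ and every output of TSMP$_2(\kappa)$ (for every subspace estimator and every tie-breaking) satisfies: if $\Omega\subseteq\Omega_c$ and $c(\kappa,\sigma,X_0,\Omega_c)\ge c$, then $\hat\Omega=\Omega$. In particular, the probability that $\Omega\subseteq\Omega_c$ and $c(\kappa,\sigma,X_0,\Omega_c)\ge c$ hold but the algorithm does not output $\Omega$ is less than $m\exp(-c^2/2)$; for a fixed set $J\supseteq\Omega$ with $c(\kappa,\sigma,X_0,J)>0$ one may take $c=c(\kappa,\sigma,X_0,J)$. -/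

import Mathlib

open MeasureTheory ProbabilityTheory
open scoped NNReal Matrix

noncomputable section

namespace MMV

variable {𝕜 : Type*} [RCLike 𝕜]

/-! ### Moore-Penrose pseudoinverse -/

/-- The four Penrose equations: `B` is the Moore-Penrose pseudoinverse of `A`. -/
structure IsMoorePenrose {p q : Type*} [Fintype p] [Fintype q]
    (A : Matrix p q 𝕜) (B : Matrix q p 𝕜) : Prop where
  mul_mul_left : A * B * A = A
  mul_mul_right : B * A * B = B
  isHermitian_left : (A * B).IsHermitian
  isHermitian_right : (B * A).IsHermitian

open scoped ComplexOrder in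
/-- Every matrix has a Moore-Penrose pseudoinverse. -/
theorem exists_isMoorePenrose {p q : Type*} [Fintype p] [Fintype q]
    (A : Matrix p q 𝕜) : ∃ B : Matrix q p 𝕜, IsMoorePenrose A B := by
  classical
  have hG : (Aᴴ * A).IsHermitian := Matrix.isHermitian_conjTranspose_mul_self A
  obtain ⟨H, hH, hcomm, hGHG, hHGH⟩ : ∃ H : Matrix q q 𝕜, H.IsHermitian ∧
      H * (Aᴴ * A) = (Aᴴ * A) * H ∧ (Aᴴ * A) * H * (Aᴴ * A) = Aᴴ * A ∧
      H * (Aᴴ * A) * H = H := by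
    set U : Matrix q q 𝕜 := (hG.eigenvectorUnitary : Matrix q q 𝕜) with hU
    have hUU : Uᴴ * U = 1 := by
      have := Unitary.coe_star_mul_self hG.eigenvectorUnitary
      simpa [Matrix.star_eq_conjTranspose] using this
    set d : q → 𝕜 := fun i => (hG.eigenvalues i : 𝕜) with hd
    have hspec : Aᴴ * A = U * Matrix.diagonal d * Uᴴ := by
      have := hG.spectral_theorem
      rw [Unitary.conjStarAlgAut_apply] at this
      exact this
    have key : ∀ a b : q → 𝕜, (U * Matrix.diagonal a * Uᴴ) * (U * Matrix.diagonal b * Uᴴ)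
        = U * Matrix.diagonal (fun i => a i * b i) * Uᴴ := by
      intro a b
      rw [← Matrix.diagonal_mul_diagonal]
      calc (U * Matrix.diagonal a * Uᴴ) * (U * Matrix.diagonal b * Uᴴ)
          = U * Matrix.diagonal a * (Uᴴ * U) * Matrix.diagonal b * Uᴴ := by
            simp only [Matrix.mul_assoc]
        _ = _ := by rw [hUU]; simp only [Matrix.mul_assoc, Matrix.mul_one]
    refine ⟨U * Matrix.diagonal (fun i => (d i)⁻¹) * Uᴴ, ?_, ?_, ?_, ?_⟩
    · rw [Matrix.IsHermitian]
      simp only [Matrix.conjTranspose_mul, Matrix.conjTranspose_conjTranspose,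
        Matrix.diagonal_conjTranspose, Matrix.mul_assoc]
      congr 3
      ext i
      simp [hd]
    · rw [hspec, key, key]
      simp only [mul_comm]
    · rw [hspec, key, key]
      congr 3
      ext i
      exact mul_inv_mul_cancel (d i)
    · rw [hspec, key, key]
      congr 3
      ext i
      by_cases h : d i = 0 <;> simp [h]
  refine ⟨H * Aᴴ, ?_, ?_, ?_, ?_⟩
  · have h0 : Aᴴ * A * (H * (Aᴴ * A) - 1) = 0 := by
      rw [Matrix.mul_sub, ← Matrix.mul_assoc, hGHG, Matrix.mul_one, sub_self]
    have h1 := (Matrix.conjTranspose_mul_self_mul_eq_zero A _).1 h0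
    rw [Matrix.mul_sub, Matrix.mul_one, sub_eq_zero] at h1
    simpa only [Matrix.mul_assoc] using h1
  · calc H * Aᴴ * A * (H * Aᴴ) = (H * (Aᴴ * A) * H) * Aᴴ := by simp only [Matrix.mul_assoc]
      _ = H * Aᴴ := by rw [hHGH]
  · rw [Matrix.IsHermitian]
    simp only [Matrix.conjTranspose_mul, Matrix.conjTranspose_conjTranspose, hH.eq,
      Matrix.mul_assoc]
  · rw [Matrix.IsHermitian, Matrix.mul_assoc, Matrix.conjTranspose_mul, hH.eq, hG.eq, hcomm]

/-- The Moore-Penrose pseudoinverse `A†`. -/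
def pinv {p q : Type*} [Fintype p] [Fintype q] (A : Matrix p q 𝕜) : Matrix q p 𝕜 :=
  (exists_isMoorePenrose A).choose

theorem pinv_spec {p q : Type*} [Fintype p] [Fintype q] (A : Matrix p q 𝕜) :
    IsMoorePenrose A (pinv A) :=
  (exists_isMoorePenrose A).choose_spec

/-! ### Rows, columns, support, singular values -/

/-- The Euclidean norm of the row `i` of a matrix. -/
def rowNorm {ι : Type*} {l : ℕ} (X : Matrix ι (Fin l) 𝕜) (i : ι) : ℝ :=
  ‖WithLp.toLp 2 (X i)‖

/-- The set of indices of the nonzero rows of a matrix. -/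
def rowSupport {n l : ℕ} (X : Matrix (Fin n) (Fin l) 𝕜) : Finset (Fin n) :=
  open Classical in Finset.univ.filter fun i => X i ≠ 0

/-- The submatrix `Φ_J` of the columns of `Φ` indexed by `J`. -/
def colSub {m n : ℕ} (Φ : Matrix (Fin m) (Fin n) 𝕜) (J : Finset (Fin n)) :
    Matrix (Fin m) J 𝕜 :=
  Φ.submatrix id Subtype.val

/-- The column `j` of `Φ`, as a vector of the Euclidean space `𝕜^m`. -/
def colVec {m n : ℕ} (Φ : Matrix (Fin m) (Fin n) 𝕜) (j : Fin n) : EuclideanSpace 𝕜 (Fin m) :=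
  WithLp.toLp 2 (fun i => Φ i j)

/-- The range of `Φ_J`, i.e. the span of the columns of `Φ` indexed by `J`. -/
def colRange {m n : ℕ} (Φ : Matrix (Fin m) (Fin n) 𝕜) (J : Finset (Fin n)) :
    Submodule 𝕜 (EuclideanSpace 𝕜 (Fin m)) :=
  Submodule.span 𝕜 (colVec Φ '' (J : Set (Fin n)))

/-- The `|J|`-th largest singular value of `Φ_J` (the singular values in Mathlib are indexed
from `0`). -/
def sigmaMin {m n : ℕ} (Φ : Matrix (Fin m) (Fin n) 𝕜) (J : Finset (Fin n)) : ℝ :=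
  (Matrix.toEuclideanLin (colSub Φ J)).singularValues (J.card - 1)

/-- The quantity `c(s, σ, J) = s * σ_{|J|}(Φ_J) / (2 σ) - √|J| - 1`. -/
def cConst {m n : ℕ} (Φ : Matrix (Fin m) (Fin n) 𝕜) (s σ : ℝ) (J : Finset (Fin n)) : ℝ :=
  s * sigmaMin Φ J / (2 * σ) - √(J.card : ℝ) - 1

/-! ### The algorithms

Each algorithm contains choices (ties in an arg max or in the `k` largest values), so it is
described by the relation "is a possible output". -/

/-- The quantity maximized in `submp`:
`‖P_{R(P⊥_{R(Φ_Γ)} S)} φ_j‖ / ‖P⊥_{R(Φ_Γ)} φ_j‖`, with the convention `0 / 0 = 0`. -/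
def submpScore {m n : ℕ} (Φ : Matrix (Fin m) (Fin n) 𝕜)
    (S : Submodule 𝕜 (EuclideanSpace 𝕜 (Fin m))) (Γ : Finset (Fin n)) (j : Fin n) : ℝ :=
  ‖(S.map ((colRange Φ Γ)ᗮ.starProjection :
      EuclideanSpace 𝕜 (Fin m) →ₗ[𝕜] EuclideanSpace 𝕜 (Fin m))).starProjection (colVec Φ j)‖ /
    ‖(colRange Φ Γ)ᗮ.starProjection (colVec Φ j)‖

/-- `SubmpOutput Φ S Γ₀ s Γ`: the greedy selection `submp(S, Γ₀, s)`, which adds `s` indices to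
`Γ₀` one at a time, each maximizing `submpScore` over the indices not yet selected, can
return `Γ`. -/
inductive SubmpOutput {m n : ℕ} (Φ : Matrix (Fin m) (Fin n) 𝕜)
    (S : Submodule 𝕜 (EuclideanSpace 𝕜 (Fin m))) (Γ₀ : Finset (Fin n)) :
    ℕ → Finset (Fin n) → Prop
  | zero : SubmpOutput Φ S Γ₀ 0 Γ₀
  | succ {i : ℕ} {Γ : Finset (Fin n)} {a : Fin n} (h : SubmpOutput Φ S Γ₀ i Γ) (ha : a ∉ Γ)
      (hmax : ∀ b, b ∉ Γ → submpScore Φ S Γ b ≤ submpScore Φ S Γ a) :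
      SubmpOutput Φ S Γ₀ (i + 1) (insert a Γ)

/-- `ζ_j`, the Euclidean norm of the row `j` of `Φ_J† Y`, for `j ∈ J`. -/
def zeta {m n l : ℕ} (Φ : Matrix (Fin m) (Fin n) 𝕜) (Y : Matrix (Fin m) (Fin l) 𝕜)
    (J : Finset (Fin n)) (j : J) : ℝ :=
  rowNorm (pinv (colSub Φ J) * Y) j

/-- The estimate of the signal matrix: its rows indexed by `Q` are those of `Φ_Q† Y`, its other
rows are zero. -/
def signalEstimate {m n l : ℕ} (Φ : Matrix (Fin m) (Fin n) 𝕜) (Y : Matrix (Fin m) (Fin l) 𝕜)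
    (Q : Finset (Fin n)) : Matrix (Fin n) (Fin l) 𝕜 :=
  fun j => if h : j ∈ Q then (pinv (colSub Φ Q) * Y) ⟨j, h⟩ else 0

/-- `ESMS₁(J, k)` can return `(Q, X)`: `Q` consists of the indices of `k` largest `ζ_j`, `j ∈ J`
(of all of them if `k` exceeds `|J|`). -/
def ESMS₁Output {m n l : ℕ} (Φ : Matrix (Fin m) (Fin n) 𝕜) (Y : Matrix (Fin m) (Fin l) 𝕜)
    (J : Finset (Fin n)) (k : ℕ) (Q : Finset (Fin n)) (X : Matrix (Fin n) (Fin l) 𝕜) : Prop :=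
  Q ⊆ J ∧ Q.card = min k J.card ∧
    (∀ a b : J, (a : Fin n) ∈ Q → (b : Fin n) ∉ Q → zeta Φ Y J b ≤ zeta Φ Y J a) ∧
    X = signalEstimate Φ Y Q

/-- `ESMS₂(J, κ)` returns `(Q, X)`: `Q` consists of the indices `j ∈ J` with `ζ_j > κ`. -/
def ESMS₂Output {m n l : ℕ} (Φ : Matrix (Fin m) (Fin n) 𝕜) (Y : Matrix (Fin m) (Fin l) 𝕜)
    (J : Finset (Fin n)) (κ : ℝ) (Q : Finset (Fin n)) (X : Matrix (Fin n) (Fin l) 𝕜) : Prop :=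
  Q ⊆ J ∧ (∀ a : J, (a : Fin n) ∈ Q ↔ κ < zeta Φ Y J a) ∧ X = signalEstimate Φ Y Q

/-- `TSMP₁(k)` with input `(Y, Φ)` can return `(Ωc, Ωhat, Xhat)`. Its first step is an arbitrary
subspace estimator `est`, applied to `Y`. -/
def TSMP₁Output {m n l : ℕ}
    (est : Matrix (Fin m) (Fin l) 𝕜 → Submodule 𝕜 (EuclideanSpace 𝕜 (Fin m)))
    (k : ℕ) (Φ : Matrix (Fin m) (Fin n) 𝕜) (Y : Matrix (Fin m) (Fin l) 𝕜)
    (Ωc Ωhat : Finset (Fin n)) (Xhat : Matrix (Fin n) (Fin l) 𝕜) : Prop :=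
  SubmpOutput Φ (est Y) ∅ (m - 1) Ωc ∧ ESMS₁Output Φ Y Ωc k Ωhat Xhat

/-- `TSMP₂(κ)` with input `(Y, Φ)` can return `(Ωc, Ωhat, Xhat)`. Its first step is an arbitrary
subspace estimator `est`, applied to `Y`. -/
def TSMP₂Output {m n l : ℕ}
    (est : Matrix (Fin m) (Fin l) 𝕜 → Submodule 𝕜 (EuclideanSpace 𝕜 (Fin m)))
    (κ : ℝ) (Φ : Matrix (Fin m) (Fin n) 𝕜) (Y : Matrix (Fin m) (Fin l) 𝕜)
    (Ωc Ωhat : Finset (Fin n)) (Xhat : Matrix (Fin n) (Fin l) 𝕜) : Prop :=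
  SubmpOutput Φ (est Y) ∅ (m - 1) Ωc ∧ ESMS₂Output Φ Y Ωc κ Ωhat Xhat

/-- The measurement matrix `Y = Φ X₀ + W`, for a noise matrix `W` with real entries. -/
def measurement {m n l : ℕ} (Φ : Matrix (Fin m) (Fin n) 𝕜) (X₀ : Matrix (Fin n) (Fin l) 𝕜)
    (W : Matrix (Fin m) (Fin l) ℝ) : Matrix (Fin m) (Fin l) 𝕜 :=
  Φ * X₀ + W.map (fun x => (x : 𝕜))

end MMV

end

/-! The only randomness that matters is the operator norm of `W`. For `J ⊇ Ω` with `σ_{|J|}(Φ_J) >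
0` the pseudoinverse is a left inverse of `Φ_J`, so row `j` of `Φ_J† Y` is row `j` of `X₀` plus row
`j` of `Φ_J† W`. Rows of `Φ_J†` have norm at most `1/σ_{|J|}(Φ_J)`, hence `|ζ_j - ‖X₀ j‖| ≤ ‖W‖ /
σ_{|J|}(Φ_J)` (`abs_zeta_sub_rowNorm_mul_le`). If this is below `κ`, the threshold `κ` strictly
separates the rows in `Ω` (norm at least `2κ`) from the zero rows, whatever the ties. Of the greedy
stage only `|Ωc| = m - 1` is used: it gives `√m < √|Ωc| + 1` for `m ≥ 2`, so `‖W‖ ≤ σ(2√m + 2c)`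
suffices. As this bound does not involve `Ωc`, one event serves all estimators and outputs.

The tail of `‖W‖` comes from Slepian's inequality (`measureReal_exists_le_of_covariance_le`), proved
by Gaussian interpolation. For unit `u, v`, the form `uᵀGv + γ`, with `γ` an independent standard
normal, is compared with `⟨g,u⟩ + ⟨h,v⟩`. Both have variance 2, and the covariances differ by `(1 -
⟨u,u'⟩)(1 - ⟨v,v'⟩) ≥ 0`. The second process is at most `√2 ‖(g,h)‖`, which a Chernoff bound
controls. This gives `2 exp(-c'²)` for every `c' < c`, and `c' = 9c/10` beats `m exp(-c²/2)` once `m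
≥ 2`. For `m = 1` all index sets are empty. -/

namespace MMV

/-! ### Gaussian integration by parts and interpolation. -/

section GaussianComparison

/-- The standard Gaussian measure on `K → ℝ`, as a product measure. -/
noncomputable abbrev stdPi (K : Type*) [Fintype K] : Measure (K → ℝ) :=
  Measure.pi fun _ => gaussianReal 0 1

theorem hasDerivAt_gaussianPDFReal_std (x : ℝ) :
    HasDerivAt (gaussianPDFReal 0 1) (-x * gaussianPDFReal 0 1 x) x := by
  have h : HasDerivAt (fun x : ℝ => (√(2 * Real.pi * (1 : ℝ≥0)))⁻¹ *
      Real.exp (-(x - 0) ^ 2 / (2 * (1 : ℝ≥0)))) (-x * gaussianPDFReal 0 1 x) x := by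
    have h1 : HasDerivAt (fun x : ℝ => -(x - 0) ^ 2 / (2 * ((1 : ℝ≥0) : ℝ))) (-x) x := by
      have := (((hasDerivAt_id x).sub_const 0).pow 2).neg.div_const (2 * ((1 : ℝ≥0) : ℝ))
      refine this.congr_deriv ?_
      norm_num
      ring
    have := (h1.exp).const_mul ((√(2 * Real.pi * (1 : ℝ≥0)))⁻¹)
    refine this.congr_deriv ?_
    simp only [gaussianPDFReal]
    ring
  exact h

/-- Gaussian integration by parts in one variable. -/
theorem integral_mul_gaussianReal {f f' : ℝ → ℝ} {C : ℝ} (hf : ∀ x, HasDerivAt f (f' x) x)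
    (hf' : Continuous f') (hC : ∀ x, |f x| ≤ C) (hC' : ∀ x, |f' x| ≤ C) :
    ∫ x, x * f x ∂gaussianReal 0 1 = ∫ x, f' x ∂gaussianReal 0 1 := by
  have hfc : Continuous f := continuous_iff_continuousAt.2 fun x => (hf x).continuousAt
  have hint := integrable_gaussianPDFReal 0 1
  have hxint : Integrable (fun x => -x * gaussianPDFReal 0 1 x) := by
    have h := integrable_mul_exp_neg_mul_sq (b := 1 / 2) (by norm_num)
    refine (h.const_mul (-(√(2 * Real.pi * (1 : ℝ≥0)))⁻¹)).congr (ae_of_all _ fun x => ?_)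
    simp only [gaussianPDFReal, sub_zero, NNReal.coe_one, mul_one]
    rw [show -(1 / 2) * x ^ 2 = -x ^ 2 / 2 by ring]
    ring
  have h := integral_mul_deriv_eq_deriv_mul_of_integrable (u := f) (v := gaussianPDFReal 0 1)
    (fun x _ => hf x) (fun x _ => hasDerivAt_gaussianPDFReal_std x)
    (hxint.bdd_mul hfc.aestronglyMeasurable (ae_of_all _ hC))
    (hint.bdd_mul hf'.aestronglyMeasurable (ae_of_all _ hC'))
    (hint.bdd_mul hfc.aestronglyMeasurable (ae_of_all _ hC))
  rw [integral_gaussianReal_eq_integral_smul one_ne_zero,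
    integral_gaussianReal_eq_integral_smul one_ne_zero]
  simp only [smul_eq_mul]
  calc ∫ x, gaussianPDFReal 0 1 x * (x * f x) = - ∫ x, f x * (-x * gaussianPDFReal 0 1 x) := by
        rw [← integral_neg]; congr 1; ext x; ring
    _ = ∫ x, f' x * gaussianPDFReal 0 1 x := by rw [h, neg_neg]
    _ = _ := by congr 1; ext x; ring

variable {K : Type*} [Fintype K]

/-- Resampling one coordinate independently preserves the product law. With Fubini this reduces
integration by parts in several variables to one. -/
theorem measurePreserving_update_stdPi [DecidableEq K] (k : K) :
    MeasurePreserving (fun p : ℝ × (K → ℝ) => Function.update p.2 k p.1)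
      ((gaussianReal 0 1).prod (stdPi K)) (stdPi K) := by
  have hm : Measurable (fun p : ℝ × (K → ℝ) => Function.update p.2 k p.1) := by
    refine measurable_pi_iff.2 fun i => ?_
    by_cases h : i = k
    · subst h; simpa using measurable_fst
    · simp only [Function.update_of_ne h]
      exact (measurable_pi_apply i).comp measurable_snd
  refine ⟨hm, (Measure.pi_eq fun s hs => ?_).symm⟩
  rw [Measure.map_apply hm (MeasurableSet.univ_pi hs)]
  have : (fun p : ℝ × (K → ℝ) => Function.update p.2 k p.1) ⁻¹' (Set.univ.pi s) =
      s k ×ˢ Set.univ.pi (Function.update s k Set.univ) := by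
    ext ⟨x, ξ⟩
    simp only [Set.mem_preimage, Set.mem_pi, Set.mem_univ, true_implies, Set.mem_prod]
    constructor
    · intro h
      refine ⟨by simpa using h k, fun i => ?_⟩
      by_cases hi : i = k
      · subst hi; simp
      · simpa [hi] using h i
    · rintro ⟨h1, h2⟩ i
      by_cases hi : i = k
      · subst hi; simpa using h1
      · simpa [hi] using h2 i
  rw [this, Measure.prod_prod, Measure.pi_pi,
    ← Finset.mul_prod_erase Finset.univ _ (Finset.mem_univ k),
    ← Finset.mul_prod_erase Finset.univ (fun i => gaussianReal 0 1 (s i)) (Finset.mem_univ k)]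
  simp only [Function.update_self, measure_univ, one_mul]
  congr 1
  refine Finset.prod_congr rfl fun i hi => ?_
  rw [Function.update_of_ne (Finset.ne_of_mem_erase hi)]

theorem integrable_eval_stdPi (k : K) : Integrable (fun ξ : K → ℝ => ξ k) (stdPi K) := by
  have h : Integrable (fun x : ℝ => x) (gaussianReal 0 1) :=
    (memLp_id_gaussianReal (μ := 0) (v := 1) 1).integrable (by simp)
  exact (measurePreserving_eval (fun _ : K => gaussianReal 0 1) k).integrable_comp_of_integrable h

/-- Gaussian integration by parts in several variables. -/
theorem integral_eval_mul_stdPi [DecidableEq K] (k : K) {f f' : (K → ℝ) → ℝ} {C : ℝ}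
    (hf : ∀ ξ x, HasDerivAt (fun y => f (Function.update ξ k y)) (f' (Function.update ξ k x)) x)
    (hfc : Continuous f) (hf' : Continuous f') (hC : ∀ x, |f x| ≤ C) (hC' : ∀ x, |f' x| ≤ C) :
    ∫ ξ, ξ k * f ξ ∂stdPi K = ∫ ξ, f' ξ ∂stdPi K := by
  have hmp := measurePreserving_update_stdPi (K := K) k
  have hi1 : Integrable (fun ξ : K → ℝ => ξ k * f ξ) (stdPi K) :=
    (integrable_eval_stdPi k).mul_bdd hfc.aestronglyMeasurable (ae_of_all _ hC)
  have hi2 : Integrable f' (stdPi K) :=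
    (integrable_const C).mono' hf'.aestronglyMeasurable (ae_of_all _ hC')
  have e1 := hmp.map_eq ▸ integral_map hmp.measurable.aemeasurable
    (f := fun ξ : K → ℝ => ξ k * f ξ) (by rw [hmp.map_eq]; exact hi1.1)
  have e2 := hmp.map_eq ▸ integral_map hmp.measurable.aemeasurable
    (f := f') (by rw [hmp.map_eq]; exact hi2.1)
  rw [e1, e2, integral_prod_symm (fun p : ℝ × (K → ℝ) => Function.update p.2 k p.1 k *
      f (Function.update p.2 k p.1)) (hmp.integrable_comp_of_integrable hi1),
    integral_prod_symm (fun p : ℝ × (K → ℝ) => f' (Function.update p.2 k p.1))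
      (hmp.integrable_comp_of_integrable hi2)]
  congr 1
  ext ξ
  simp only [Function.update_self]
  exact integral_mul_gaussianReal (hf ξ)
    (hf'.comp (continuous_const.update k continuous_id)) (fun x => hC _) (fun x => hC' _)

variable {I : Type*} [Fintype I]

/-- A comparison inequality for Gaussian vectors: `F` is a function with mixed second derivatives
of a constant sign where the covariances differ. -/
theorem integral_le_integral_of_covariance_le {F : (I → ℝ) → ℝ} {F₁ : I → (I → ℝ) → ℝ}
    {F₂ : I → I → (I → ℝ) → ℝ} {C : ℝ}
    (hF : ∀ z, HasFDerivAt F (∑ i, F₁ i z • ContinuousLinearMap.proj (R := ℝ) i) z)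
    (hF₁ : ∀ i z, HasFDerivAt (F₁ i) (∑ j, F₂ i j z • ContinuousLinearMap.proj (R := ℝ) j) z)
    (hF₂ : ∀ i j, Continuous (F₂ i j)) (hC : ∀ z, |F z| ≤ C) (hC₁ : ∀ i z, |F₁ i z| ≤ C)
    (hC₂ : ∀ i j z, |F₂ i j z| ≤ C) (a b : I → K → ℝ) (hab : ∀ i j, ∑ k, a i k * b j k = 0)
    (hcov : ∀ i j z, 0 ≤ ((∑ k, a i k * a j k) - ∑ k, b i k * b j k) * F₂ i j z) :
    ∫ ξ, F (fun i => ∑ k, b i k * ξ k) ∂stdPi K ≤ ∫ ξ, F (fun i => ∑ k, a i k * ξ k) ∂stdPi K := by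
  classical
  have hFc : Continuous F := continuous_iff_continuousAt.2 fun z => (hF z).continuousAt
  have hF₁c : ∀ i, Continuous (F₁ i) :=
    fun i => continuous_iff_continuousAt.2 fun z => (hF₁ i z).continuousAt
  -- Rotation from the `b` process at `θ = 0` to the `a` process at `θ = π/2`; `hab` makes the two
  -- processes independent.
  set v : ℝ → I → K → ℝ := fun θ i k => Real.sin θ * a i k + Real.cos θ * b i k with hv
  set v' : ℝ → I → K → ℝ := fun θ i k => Real.cos θ * a i k - Real.sin θ * b i k with hv'
  set Z : ℝ → (K → ℝ) → I → ℝ := fun θ ξ i => ∑ k, v θ i k * ξ k with hZ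
  have hZc : ∀ θ, Continuous (Z θ) := fun θ => by
    refine continuous_pi fun i => ?_
    fun_prop
  set D : ℝ → (K → ℝ) → ℝ := fun θ ξ => ∑ i, ∑ k, v' θ i k * (ξ k * F₁ i (Z θ ξ)) with hD
  have hZd : ∀ ξ θ, HasDerivAt (fun θ => Z θ ξ) (fun i => ∑ k, v' θ i k * ξ k) θ := by
    intro ξ θ
    refine hasDerivAt_pi.2 fun i => ?_
    refine HasDerivAt.fun_sum fun k _ => ?_
    refine HasDerivAt.mul_const ?_ _
    have := ((Real.hasDerivAt_sin θ).mul_const (a i k)).add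
      ((Real.hasDerivAt_cos θ).mul_const (b i k))
    refine this.congr_deriv ?_
    simp only [hv']; ring
  have hdiff : ∀ ξ θ, HasDerivAt (fun θ => F (Z θ ξ)) (D θ ξ) θ := by
    intro ξ θ
    refine ((hF (Z θ ξ)).comp_hasDerivAt θ (hZd ξ θ)).congr_deriv ?_
    simp only [hD, _root_.sum_apply, _root_.smul_apply,
      ContinuousLinearMap.proj_apply, smul_eq_mul, Finset.mul_sum]
    refine Finset.sum_congr rfl fun i _ => Finset.sum_congr rfl fun k _ => ?_
    ring
  have hv'le : ∀ θ i k, |v' θ i k| ≤ |a i k| + |b i k| := by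
    intro θ i k
    refine (abs_sub _ _).trans (add_le_add ?_ ?_) <;> rw [abs_mul]
    · exact mul_le_of_le_one_left (abs_nonneg _) (Real.abs_cos_le_one θ)
    · exact mul_le_of_le_one_left (abs_nonneg _) (Real.abs_sin_le_one θ)
  have hint : ∀ θ i k, Integrable (fun ξ : K → ℝ => ξ k * F₁ i (Z θ ξ)) (stdPi K) :=
    fun θ i k => (integrable_eval_stdPi k).mul_bdd
      ((hF₁c i).comp (hZc θ)).aestronglyMeasurable (ae_of_all _ fun ξ => hC₁ i _)
  have hder : ∀ θ, HasDerivAt (fun θ => ∫ ξ, F (Z θ ξ) ∂stdPi K) (∫ ξ, D θ ξ ∂stdPi K) θ := by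
    intro θ
    refine (hasDerivAt_integral_of_dominated_loc_of_deriv_le (s := Set.univ) Filter.univ_mem
      (bound := fun ξ => ∑ i, ∑ k, (|a i k| + |b i k|) * (|ξ k| * C))
      (Filter.Eventually.of_forall fun θ => (hFc.comp (hZc θ)).aestronglyMeasurable)
      ((integrable_const C).mono' (hFc.comp (hZc θ)).aestronglyMeasurable
        (ae_of_all _ fun ξ => hC _)) ?_ ?_ ?_ ?_).2
    · exact (integrable_finsetSum _ fun i _ => integrable_finsetSum _ fun k _ =>
        (hint θ i k).const_mul _).1
    · refine ae_of_all _ fun ξ θ _ => ?_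
      refine (Finset.abs_sum_le_sum_abs _ _).trans (Finset.sum_le_sum fun i _ => ?_)
      refine (Finset.abs_sum_le_sum_abs _ _).trans (Finset.sum_le_sum fun k _ => ?_)
      rw [abs_mul, abs_mul]
      exact mul_le_mul (hv'le θ i k) (mul_le_mul_of_nonneg_left (hC₁ _ _) (abs_nonneg _))
        (by positivity) (by positivity)
    · exact integrable_finsetSum _ fun i _ => integrable_finsetSum _ fun k _ =>
        (((integrable_eval_stdPi k).abs).mul_const C).const_mul _
    · exact ae_of_all _ fun ξ θ _ => hdiff ξ θ
  have hparts : ∀ θ i k, ∫ ξ, ξ k * F₁ i (Z θ ξ) ∂stdPi K =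
      ∑ j, v θ j k * ∫ ξ, F₂ i j (Z θ ξ) ∂stdPi K := by
    intro θ i k
    have hi : ∀ j, Integrable (fun ξ : K → ℝ => F₂ i j (Z θ ξ)) (stdPi K) := fun j =>
      (integrable_const C).mono' ((hF₂ i j).comp (hZc θ)).aestronglyMeasurable
        (ae_of_all _ fun ξ => hC₂ i j _)
    have hb : ∀ ξ : K → ℝ, |∑ j, v θ j k * F₂ i j (Z θ ξ)| ≤ ∑ j, |v θ j k| * C := fun ξ => by
      refine (Finset.abs_sum_le_sum_abs _ _).trans (Finset.sum_le_sum fun j _ => ?_)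
      rw [abs_mul]
      exact mul_le_mul_of_nonneg_left (hC₂ _ _ _) (abs_nonneg _)
    rw [integral_eval_mul_stdPi k (f := fun ξ => F₁ i (Z θ ξ))
      (f' := fun ξ => ∑ j, v θ j k * F₂ i j (Z θ ξ)) (C := max C (∑ j, |v θ j k| * C)) ?_
      ((hF₁c i).comp (hZc θ)) ?_ (fun ξ => (hC₁ _ _).trans (le_max_left _ _))
      (fun ξ => (hb ξ).trans (le_max_right _ _)), integral_finsetSum _ fun j _ => (hi j).const_mul _]
    · simp only [integral_const_mul]
    · intro ξ x
      have hu : HasDerivAt (fun y => Z θ (Function.update ξ k y)) (fun j => v θ j k) x := by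
        refine hasDerivAt_pi.2 fun j => ?_
        have h1 : HasDerivAt (fun y => Function.update ξ k y) (Pi.single k 1) x :=
          hasDerivAt_update ξ k x
        have h2 : HasDerivAt (fun y => ∑ k', v θ j k' * Function.update ξ k y k')
            (∑ k', v θ j k' * (Pi.single k 1 : K → ℝ) k') x :=
          HasDerivAt.fun_sum fun k' _ => (hasDerivAt_pi.1 h1 k').const_mul _
        refine h2.congr_deriv ?_
        simp [Pi.single_apply]
      refine ((hF₁ i _).comp_hasDerivAt x hu).congr_deriv ?_
      simp only [_root_.sum_apply, _root_.smul_apply,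
        ContinuousLinearMap.proj_apply, smul_eq_mul]
      exact Finset.sum_congr rfl fun j _ => mul_comm _ _
    · exact continuous_finsetSum _ fun j _ => continuous_const.mul ((hF₂ i j).comp (hZc θ))
  -- The `cos²` and `sin²` cross terms vanish by `hab`, leaving the difference of covariances, so
  -- `hcov` gives the sign of the derivative on `[0, π/2]`.
  have hDint : ∀ θ, ∫ ξ, D θ ξ ∂stdPi K = Real.sin θ * Real.cos θ * ∑ i, ∑ j,
      ∫ ξ, ((∑ k, a i k * a j k) - ∑ k, b i k * b j k) * F₂ i j (Z θ ξ) ∂stdPi K := by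
    intro θ
    have h1 : ∀ i j, ∑ k, v' θ i k * v θ j k =
        Real.sin θ * Real.cos θ * ((∑ k, a i k * a j k) - ∑ k, b i k * b j k) := by
      intro i j
      have : ∀ k, v' θ i k * v θ j k = Real.sin θ * Real.cos θ * (a i k * a j k) -
          Real.sin θ * Real.cos θ * (b i k * b j k) + Real.cos θ ^ 2 * (a i k * b j k) -
          Real.sin θ ^ 2 * (a j k * b i k) := fun k => by simp only [hv, hv']; ring
      simp only [this, Finset.sum_add_distrib, Finset.sum_sub_distrib, ← Finset.mul_sum, hab]
      ring
    rw [integral_finsetSum _ fun i _ => integrable_finsetSum _ fun k _ => (hint θ i k).const_mul _,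
      Finset.mul_sum]
    refine Finset.sum_congr rfl fun i _ => ?_
    rw [integral_finsetSum _ fun k _ => (hint θ i k).const_mul _, Finset.mul_sum]
    simp only [integral_const_mul, hparts, Finset.mul_sum]
    rw [Finset.sum_comm]
    refine Finset.sum_congr rfl fun j _ => ?_
    rw [← mul_assoc, ← h1, Finset.sum_mul]
    exact Finset.sum_congr rfl fun k _ => by ring
  have hmono : MonotoneOn (fun θ => ∫ ξ, F (Z θ ξ) ∂stdPi K) (Set.Icc 0 (Real.pi / 2)) := by
    refine monotoneOn_of_deriv_nonneg (convex_Icc _ _)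
      (fun θ _ => (hder θ).continuousAt.continuousWithinAt)
      (fun θ _ => (hder θ).differentiableAt.differentiableWithinAt) fun θ hθ => ?_
    rw [interior_Icc] at hθ
    rw [(hder θ).deriv, hDint]
    refine mul_nonneg (mul_nonneg (Real.sin_nonneg_of_nonneg_of_le_pi hθ.1.le ?_)
      (Real.cos_nonneg_of_neg_pi_div_two_le_of_le ?_ hθ.2.le))
      (Finset.sum_nonneg fun i _ => Finset.sum_nonneg fun j _ =>
        integral_nonneg fun ξ => hcov i j _)
    · linarith [hθ.2, Real.pi_pos]
    · linarith [hθ.1, Real.pi_pos]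
  have h := hmono (Set.left_mem_Icc.2 (by positivity)) (Set.right_mem_Icc.2 (by positivity))
    (by positivity)
  simpa [hZ, hv] using h

end GaussianComparison

/-! ### Slepian's inequality. -/

section Slepian

/-- A smooth decreasing cutoff function, equal to `1` up to `t` and to `0` from `t + δ` on. -/
theorem exists_smooth_cutoff (t : ℝ) {δ : ℝ} (hδ : 0 < δ) :
    ∃ (φ φ' φ'' : ℝ → ℝ) (C : ℝ), (∀ x, HasDerivAt φ (φ' x) x) ∧ (∀ x, HasDerivAt φ' (φ'' x) x) ∧
      Continuous φ'' ∧ (∀ x, 0 ≤ φ x) ∧ (∀ x, φ x ≤ 1) ∧ (∀ x, φ' x ≤ 0) ∧ (∀ x, |φ' x| ≤ C) ∧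
      (∀ x, |φ'' x| ≤ C) ∧ (∀ x ≤ t, φ x = 1) ∧ ∀ x, t + δ ≤ x → φ x = 0 := by
  set φ : ℝ → ℝ := fun x => Real.smoothTransition ((t + δ - x) / δ) with hφ
  have hsm : ContDiff ℝ 2 φ := by
    have h : ContDiff ℝ 2 Real.smoothTransition := Real.smoothTransition.contDiff (n := 2)
    exact h.comp (by fun_prop)
  have h1 : ∀ x ≤ t, φ x = 1 := fun x hx =>
    Real.smoothTransition.one_of_one_le (by rw [le_div_iff₀ hδ]; linarith)
  have h0 : ∀ x, t + δ ≤ x → φ x = 0 := fun x hx =>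
    Real.smoothTransition.zero_of_nonpos (div_nonpos_of_nonpos_of_nonneg (by linarith) hδ.le)
  have hanti : Antitone φ := fun x y hxy =>
    Real.smoothTransition.monotone (by gcongr)
  have hsm' : ContDiff ℝ 1 (deriv φ) := hsm.deriv' (n := 1)
  -- Both derivatives vanish off `[t, t + δ]`, so compactness bounds them globally.
  have hout : ∀ x, x ∉ Set.Icc t (t + δ) → ∃ c : ℝ, φ =ᶠ[nhds x] fun _ => c := by
    intro x hx
    rw [Set.mem_Icc, not_and_or, not_le, not_le] at hx
    rcases hx with hx | hx
    · exact ⟨1, Filter.mem_of_superset (Iio_mem_nhds hx) fun y hy => h1 y (le_of_lt hy)⟩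
    · exact ⟨0, Filter.mem_of_superset (Ioi_mem_nhds hx) fun y hy => h0 y (le_of_lt hy)⟩
  have hout' : ∀ x, x ∉ Set.Icc t (t + δ) → deriv φ =ᶠ[nhds x] fun _ => 0 := by
    intro x hx
    obtain ⟨c, hc⟩ := hout x hx
    simpa using hc.deriv
  have hout'' : ∀ x, x ∉ Set.Icc t (t + δ) → deriv (deriv φ) x = 0 := by
    intro x hx
    simpa using (hout' x hx).deriv_eq
  have hc2 : Continuous (deriv (deriv φ)) := hsm'.continuous_deriv le_rfl
  obtain ⟨C₁, hC₁⟩ := (isCompact_Icc (a := t) (b := t + δ)).exists_bound_of_continuousOn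
    hsm'.continuous.continuousOn
  obtain ⟨C₂, hC₂⟩ := (isCompact_Icc (a := t) (b := t + δ)).exists_bound_of_continuousOn
    hc2.continuousOn
  refine ⟨φ, deriv φ, deriv (deriv φ), max 0 (max C₁ C₂),
    fun x => ((hsm.differentiable (by norm_num)) x).hasDerivAt,
    fun x => ((hsm'.differentiable (by norm_num)) x).hasDerivAt, hc2,
    fun x => Real.smoothTransition.nonneg _, fun x => Real.smoothTransition.le_one _,
    fun x => hanti.deriv_nonpos, fun x => ?_, fun x => ?_, h1, h0⟩
  · by_cases hx : x ∈ Set.Icc t (t + δ)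
    · exact (hC₁ x hx).trans ((le_max_left _ _).trans (le_max_right _ _))
    · simp [(hout' x hx).eq_of_nhds]
  · by_cases hx : x ∈ Set.Icc t (t + δ)
    · exact (hC₂ x hx).trans ((le_max_right _ _).trans (le_max_right _ _))
    · simp [hout'' x hx]

variable {K I : Type*} [Fintype K] [Fintype I]

/-- Each partial derivative is written with `Function.update` so that it is again a product of
one-variable functions; the lemma then also yields the second derivatives. -/
theorem hasFDerivAt_prod_eval [DecidableEq I] {g g' : I → ℝ → ℝ}
    (hg : ∀ i x, HasDerivAt (g i) (g' i x) x) (z : I → ℝ) :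
    HasFDerivAt (fun z : I → ℝ => ∏ j, g j (z j))
      (∑ i, (∏ j, Function.update g i (g' i) j (z j)) •
        ContinuousLinearMap.proj (R := ℝ) (φ := fun _ : I => ℝ) i) z := by
  have h : ∀ i ∈ Finset.univ, HasFDerivAt (fun z : I → ℝ => g i (z i))
      (g' i (z i) • ContinuousLinearMap.proj (R := ℝ) (φ := fun _ : I => ℝ) i) z := fun i _ =>
    (hg i (z i)).comp_hasFDerivAt z (hasFDerivAt_apply i z)
  refine (HasFDerivAt.finsetProd h).congr_fderiv ?_
  refine Finset.sum_congr rfl fun i _ => ?_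
  rw [smul_smul, ← Finset.mul_prod_erase _ _ (Finset.mem_univ i), Function.update_self, mul_comm]
  congr 2
  refine Finset.prod_congr rfl fun j hj => ?_
  rw [Function.update_of_ne (Finset.ne_of_mem_erase hj)]

/-- Slepian's inequality, for a smooth cutoff function. -/
theorem integral_prod_le_integral_prod {φ φ' φ'' : ℝ → ℝ} {C : ℝ}
    (h1 : ∀ x, HasDerivAt φ (φ' x) x) (h2 : ∀ x, HasDerivAt φ' (φ'' x) x) (hc : Continuous φ'')
    (h0 : ∀ x, 0 ≤ φ x) (hle : ∀ x, φ x ≤ 1) (hneg : ∀ x, φ' x ≤ 0) (hC₁ : ∀ x, |φ' x| ≤ C)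
    (hC₂ : ∀ x, |φ'' x| ≤ C) (a b : I → K → ℝ) (hab : ∀ i j, ∑ k, a i k * b j k = 0)
    (hdiag : ∀ i, ∑ k, a i k * a i k = ∑ k, b i k * b i k)
    (hcov : ∀ i j, ∑ k, b i k * b j k ≤ ∑ k, a i k * a j k) :
    ∫ ξ, ∏ i, φ (∑ k, b i k * ξ k) ∂stdPi K ≤ ∫ ξ, ∏ i, φ (∑ k, a i k * ξ k) ∂stdPi K := by
  classical
  have hφ : Continuous φ := continuous_iff_continuousAt.2 fun z => (h1 z).continuousAt
  have hφ' : Continuous φ' := continuous_iff_continuousAt.2 fun z => (h2 z).continuousAt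
  set D := max 1 C with hD
  have bd : ∀ g : I → ℝ → ℝ, (∀ i x, |g i x| ≤ D) → ∀ z : I → ℝ,
      |∏ j, g j (z j)| ≤ D ^ Fintype.card I := by
    intro g hg z
    rw [Finset.abs_prod, ← Finset.card_univ, ← Finset.prod_const]
    exact Finset.prod_le_prod (fun _ _ => abs_nonneg _) fun i _ => hg i _
  have b0 : ∀ x, |φ x| ≤ D := fun x => by
    rw [abs_of_nonneg (h0 x)]; exact (hle x).trans (le_max_left _ _)
  have b1 : ∀ x, |φ' x| ≤ D := fun x => (hC₁ x).trans (le_max_right _ _)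
  have b2 : ∀ x, |φ'' x| ≤ D := fun x => (hC₂ x).trans (le_max_right _ _)
  have upd : ∀ (p : (ℝ → ℝ) → Prop) (g : I → ℝ → ℝ) (i : I) (f : ℝ → ℝ), p f → (∀ j, p (g j)) →
      ∀ j, p (Function.update g i f j) := by
    intro p g i f hf hg j
    by_cases hj : j = i
    · subst hj; simpa using hf
    · simpa [hj] using hg j
  set g₁ : I → I → ℝ → ℝ := fun i => Function.update (fun _ => φ) i φ' with hg₁
  set d₁ : I → I → ℝ → ℝ := fun i => Function.update (fun _ => φ') i φ'' with hd₁
  have hg₁d : ∀ i j x, HasDerivAt (g₁ i j) (d₁ i j x) x := by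
    intro i j x
    by_cases hj : j = i
    · subst hj; simpa [hg₁, hd₁] using h2 x
    · simpa [hg₁, hd₁, hj] using h1 x
  refine integral_le_integral_of_covariance_le (F := fun z => ∏ j, φ (z j))
    (F₁ := fun i z => ∏ j, g₁ i j (z j))
    (F₂ := fun i j z => ∏ k, Function.update (g₁ i) j (d₁ i j) k (z k)) (C := D ^ Fintype.card I)
    (hasFDerivAt_prod_eval fun _ x => h1 x) (fun i => hasFDerivAt_prod_eval (hg₁d i)) ?_
    (bd _ fun _ => b0) (fun i => bd _ ?_) (fun i j => bd _ ?_) a b hab ?_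
  · intro i j
    refine continuous_finsetProd _ fun k _ => Continuous.comp ?_ (continuous_apply k)
    exact upd Continuous _ _ _ (upd Continuous _ _ _ hc (fun _ => hφ') j)
      (upd Continuous _ _ _ hφ' fun _ => hφ) k
  · exact upd (fun f => ∀ x, |f x| ≤ D) _ _ _ b1 fun _ => b0
  · exact upd (fun f => ∀ x, |f x| ≤ D) _ _ _ (upd (fun f => ∀ x, |f x| ≤ D) _ _ _ b2
      (fun _ => b1) j) (upd (fun f => ∀ x, |f x| ≤ D) _ _ _ b1 fun _ => b0)
  · intro i j z
    -- Diagonal terms drop out because the variances agree. Off the diagonal, the mixed derivative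
    -- has two factors `φ' ≤ 0` and the rest `φ ≥ 0`.
    by_cases hij : j = i
    · subst hij; rw [hdiag, sub_self, zero_mul]
    · refine mul_nonneg (sub_nonneg.2 (hcov i j)) ?_
      rw [← Finset.mul_prod_erase _ _ (Finset.mem_univ j),
        ← Finset.mul_prod_erase _ _ (Finset.mem_erase.2 ⟨Ne.symm hij, Finset.mem_univ i⟩),
        ← mul_assoc]
      refine mul_nonneg (mul_nonneg_of_nonpos_of_nonpos ?_ ?_) (Finset.prod_nonneg fun k hk => ?_)
      · simpa [hd₁, hij] using hneg _
      · simpa [hg₁, Ne.symm hij] using hneg _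
      · simp only [Finset.mem_erase] at hk
        simpa [hg₁, hk.1, hk.2.1] using h0 _

/-- Slepian's inequality. -/
theorem measureReal_exists_le_of_covariance_le (a b : I → K → ℝ)
    (hab : ∀ i j, ∑ k, a i k * b j k = 0)
    (hdiag : ∀ i, ∑ k, a i k * a i k = ∑ k, b i k * b i k)
    (hcov : ∀ i j, ∑ k, b i k * b j k ≤ ∑ k, a i k * a j k) (t : ℝ) {δ : ℝ} (hδ : 0 < δ) :
    (stdPi K).real {ξ | ∃ i, t + δ ≤ ∑ k, a i k * ξ k} ≤
      (stdPi K).real {ξ | ∃ i, t < ∑ k, b i k * ξ k} := by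
  obtain ⟨φ, φ', φ'', C, h1, h2, hc, h0, hle, hneg, hC₁, hC₂, hone, hzero⟩ :=
    exists_smooth_cutoff t hδ
  have hφ : Continuous φ := continuous_iff_continuousAt.2 fun z => (h1 z).continuousAt
  have key := integral_prod_le_integral_prod h1 h2 hc h0 hle hneg hC₁ hC₂ a b hab hdiag hcov
  have hmA : MeasurableSet {ξ : K → ℝ | ∃ i, t + δ ≤ ∑ k, a i k * ξ k} := by
    simp only [Set.ofPred_exists]
    exact MeasurableSet.iUnion fun i => measurableSet_le measurable_const (by fun_prop)
  have hmB : MeasurableSet {ξ : K → ℝ | ∃ i, t < ∑ k, b i k * ξ k} := by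
    simp only [Set.ofPred_exists]
    exact MeasurableSet.iUnion fun i => measurableSet_lt measurable_const (by fun_prop)
  have hint : ∀ a : I → K → ℝ, Integrable (fun ξ => ∏ i, φ (∑ k, a i k * ξ k)) (stdPi K) := by
    intro a
    refine (integrable_const (1 : ℝ)).mono' (Continuous.aestronglyMeasurable ?_)
      (ae_of_all _ fun ξ => ?_)
    · exact continuous_finsetProd _ fun i _ => hφ.comp (by fun_prop)
    · rw [Real.norm_eq_abs, abs_of_nonneg (Finset.prod_nonneg fun i _ => h0 _)]
      exact Finset.prod_le_one (fun i _ => h0 _) fun i _ => hle _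
  -- The product of cutoffs lies between the indicators of "all values at most `t`" and "all values
  -- below `t + δ`"; the gap `δ` is the price of smoothness.
  have hA : ∫ ξ, ∏ i, φ (∑ k, a i k * ξ k) ∂stdPi K ≤
      (stdPi K).real {ξ | ∃ i, t + δ ≤ ∑ k, a i k * ξ k}ᶜ := by
    rw [← integral_indicator_one hmA.compl]
    refine integral_mono (hint a) ((integrable_const _).indicator hmA.compl) fun ξ => ?_
    by_cases hξ : ∃ i, t + δ ≤ ∑ k, a i k * ξ k
    · obtain ⟨i, hi⟩ := id hξ
      rw [Set.indicator_of_notMem (by simpa using hξ)]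
      exact (Finset.prod_eq_zero (Finset.mem_univ i) (hzero _ hi)).le
    · rw [Set.indicator_of_mem (by simpa using hξ)]
      exact Finset.prod_le_one (fun i _ => h0 _) fun i _ => hle _
  have hB : (stdPi K).real {ξ | ∃ i, t < ∑ k, b i k * ξ k}ᶜ ≤
      ∫ ξ, ∏ i, φ (∑ k, b i k * ξ k) ∂stdPi K := by
    rw [← integral_indicator_one hmB.compl]
    refine integral_mono ((integrable_const _).indicator hmB.compl) (hint b) fun ξ => ?_
    by_cases hξ : ∃ i, t < ∑ k, b i k * ξ k
    · rw [Set.indicator_of_notMem (by simpa using hξ)]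
      exact Finset.prod_nonneg fun i _ => h0 _
    · rw [Set.indicator_of_mem (by simpa using hξ)]
      push Not at hξ
      exact (Finset.prod_eq_one fun i _ => hone _ (hξ i)).ge
  rw [probReal_compl_eq_one_sub hmA] at hA
  rw [probReal_compl_eq_one_sub hmB] at hB
  linarith

end Slepian

/-! ### Chernoff bound for the norm of a Gaussian vector. -/

section ChiTail

theorem gaussianPDFReal_std_mul_exp_sq (s x : ℝ) :
    gaussianPDFReal 0 1 x * Real.exp (s * x ^ 2) =
      (√(2 * Real.pi))⁻¹ * Real.exp (-((1 - 2 * s) / 2) * x ^ 2) := by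
  simp only [gaussianPDFReal, sub_zero, NNReal.coe_one, mul_one]
  rw [mul_assoc, ← Real.exp_add]
  congr 2
  ring

theorem integrable_exp_mul_sq_gaussianReal {s : ℝ} (hs : s < 1 / 2) :
    Integrable (fun x => Real.exp (s * x ^ 2)) (gaussianReal 0 1) := by
  rw [gaussianReal_of_var_ne_zero _ one_ne_zero,
    integrable_withDensity_iff_integrable_smul' (measurable_gaussianPDF _ _)
      (ae_of_all _ fun _ => gaussianPDF_lt_top)]
  simp only [toReal_gaussianPDF, smul_eq_mul, gaussianPDFReal_std_mul_exp_sq]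
  exact (integrable_exp_neg_mul_sq (by linarith)).const_mul _

theorem mgf_sq_gaussianReal {s : ℝ} (hs : s < 1 / 2) :
    mgf (fun x => x ^ 2) (gaussianReal 0 1) s = √(1 / (1 - 2 * s)) := by
  rw [mgf, integral_gaussianReal_eq_integral_smul one_ne_zero]
  simp only [smul_eq_mul, gaussianPDFReal_std_mul_exp_sq]
  rw [integral_const_mul, integral_gaussian, ← Real.sqrt_inv, ← Real.sqrt_mul (by positivity)]
  congr 1
  have : 1 - 2 * s ≠ 0 := by linarith
  field_simp

variable {K : Type*} [Fintype K]

/-- The upper tail of the norm of a standard Gaussian vector. -/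
theorem measureReal_le_sqrt_sum_sq_le (T : Finset K) (hT : T.Nonempty) {c : ℝ} (hc : 0 ≤ c) :
    (stdPi K).real {ξ | √(T.card : ℝ) + c ≤ √(∑ k ∈ T, ξ k ^ 2)} ≤ Real.exp (-c ^ 2 / 2) := by
  set q := √(T.card : ℝ) with hq
  have hcard : (0 : ℝ) < T.card := by exact_mod_cast hT.card_pos
  have hq0 : 0 < q := Real.sqrt_pos.2 hcard
  -- Chosen so that `1/(1 - 2s) = 1 + c/q`. Then `1 + x ≤ exp x` bounds the moment generating
  -- function of the `q²` summed squares by `exp(cq/2)`, and `s(q + c)² = c(q + c)/2` leaves exactly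
  -- `-c²/2`.
  set s := c / (2 * (q + c)) with hs
  have hs0 : 0 ≤ s := by positivity
  have hs1 : s < 1 / 2 := by
    rw [hs, div_lt_div_iff₀ (by positivity) (by norm_num)]
    linarith
  have hr : 1 / (1 - 2 * s) = 1 + c / q := by
    rw [hs]
    have : q + c ≠ 0 := by positivity
    field_simp
    ring_nf
    field_simp
  have hmgf1 : mgf (fun x => x ^ 2) (gaussianReal 0 1) s ≤ Real.exp (c / (2 * q)) := by
    rw [mgf_sq_gaussianReal hs1, hr, Real.sqrt_le_left (by positivity), ← Real.exp_nat_mul]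
    have := Real.add_one_le_exp (c / q)
    refine le_trans (by linarith) (this.trans (Real.exp_le_exp.2 (le_of_eq ?_)))
    push_cast
    field_simp
  have hind : iIndepFun (fun (k : K) (ξ : K → ℝ) => ξ k ^ 2) (stdPi K) :=
    iIndepFun_pi (X := fun _ (x : ℝ) => x ^ 2) fun _ => by fun_prop
  have hmk : ∀ k, mgf (fun ξ : K → ℝ => ξ k ^ 2) (stdPi K) s =
      mgf (fun x => x ^ 2) (gaussianReal 0 1) s := by
    intro k
    have hmp := measurePreserving_eval (fun _ : K => gaussianReal 0 1) k
    rw [← hmp.map_eq, mgf_map hmp.measurable.aemeasurable (by fun_prop)]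
    rfl
  have hmeas : ∀ k : K, Measurable (fun ξ : K → ℝ => ξ k ^ 2) := fun k => by fun_prop
  have hmgf : mgf (∑ k ∈ T, fun ξ : K → ℝ => ξ k ^ 2) (stdPi K) s ≤ Real.exp (c * q / 2) := by
    rw [hind.mgf_sum hmeas, Finset.prod_congr rfl fun k _ => hmk k, Finset.prod_const]
    refine (pow_le_pow_left₀ mgf_nonneg hmgf1 _).trans (le_of_eq ?_)
    rw [← Real.exp_nat_mul]
    congr 1
    have : (T.card : ℝ) = q ^ 2 := (Real.sq_sqrt hcard.le).symm
    rw [this]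
    field_simp
  have hint : Integrable (fun ξ => Real.exp (s * (∑ k ∈ T, fun ξ : K → ℝ => ξ k ^ 2) ξ))
      (stdPi K) := by
    refine hind.integrable_exp_mul_sum hmeas fun k _ => ?_
    have hmp := measurePreserving_eval (fun _ : K => gaussianReal 0 1) k
    exact hmp.integrable_comp_of_integrable (integrable_exp_mul_sq_gaussianReal hs1)
  have hch := measure_ge_le_exp_mul_mgf ((q + c) ^ 2) hs0 hint
  have hset : {ξ : K → ℝ | q + c ≤ √(∑ k ∈ T, ξ k ^ 2)} =
      {ξ | (q + c) ^ 2 ≤ (∑ k ∈ T, fun ξ : K → ℝ => ξ k ^ 2) ξ} := by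
    ext ξ
    simp only [Set.mem_ofPred_eq, Finset.sum_apply]
    exact Real.le_sqrt' (by positivity)
  rw [hset]
  refine hch.trans ((mul_le_mul_of_nonneg_left hmgf (Real.exp_nonneg _)).trans (le_of_eq ?_))
  rw [← Real.exp_add]
  congr 1
  rw [hs]
  field_simp
  ring

end ChiTail

/-! ### Operator norm of a Gaussian matrix. -/

section OperatorNorm

theorem measurePreserving_precomp_stdPi {K L : Type*} [Fintype K] [Fintype L] {g : L → K}
    (hg : g.Injective) :
    MeasurePreserving (fun (ξ : K → ℝ) i => ξ (g i)) (stdPi K) (stdPi L) := by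
  refine ⟨by fun_prop, ?_⟩
  have hind : iIndepFun (fun (k : K) (ξ : K → ℝ) => ξ k) (stdPi K) :=
    iIndepFun_pi (X := fun _ (x : ℝ) => x) fun _ => by fun_prop
  rw [iIndepFun.map_fun_eq_pi_map (fun i => (measurable_pi_apply (g i)).aemeasurable)
    (hind.precomp hg)]
  congr 1
  ext1 i
  exact (measurePreserving_eval (fun _ : K => gaussianReal 0 1) (g i)).map_eq

variable {p q : Type*} [Fintype p] [Fintype q]

/-- The coefficients of `∑ u r * v s * G (r, s) ± γ`. -/
def prodCoeff (e : ℝ) (u : p → ℝ) (v : q → ℝ) : ((p × q) ⊕ Unit) ⊕ (p ⊕ q) → ℝ :=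
  Sum.elim (Sum.elim (fun rs => u rs.1 * v rs.2) fun _ => e) fun _ => 0

/-- The coefficients of `∑ u r * g r + ∑ v s * h s`. -/
def sumCoeff (u : p → ℝ) (v : q → ℝ) : ((p × q) ⊕ Unit) ⊕ (p ⊕ q) → ℝ :=
  Sum.elim (fun _ => 0) (Sum.elim u v)

theorem sum_mul_le_one {r : Type*} [Fintype r] {x y : r → ℝ} (hx : ∑ i, x i ^ 2 = 1)
    (hy : ∑ i, y i ^ 2 = 1) : ∑ i, x i * y i ≤ 1 := by
  have := Real.sum_mul_le_sqrt_mul_sqrt Finset.univ x y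
  simpa [hx, hy] using this

/-- By Cauchy–Schwarz the form is at most `√2` times the norm of a Gaussian vector in dimension `|p|
+ |q| ≤ 2|p|`. Dividing the threshold by `√2` leaves `√(2|p|) + √2 c`, whence the exponent `-c²`. -/
theorem measureReal_exists_sumCoeff_le {I : Type*} (hpq : Fintype.card q ≤ Fintype.card p)
    [Nonempty p] (u : I → p → ℝ) (v : I → q → ℝ) (hu : ∀ i, ∑ r, u i r ^ 2 = 1)
    (hv : ∀ i, ∑ s, v i s ^ 2 = 1) {c : ℝ} (hc : 0 ≤ c) :
    (stdPi (((p × q) ⊕ Unit) ⊕ (p ⊕ q))).real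
      {ξ | ∃ i, 2 * √(Fintype.card p : ℝ) + 2 * c < ∑ k, sumCoeff (u i) (v i) k * ξ k} ≤
      Real.exp (-c ^ 2) := by
  classical
  set T : Finset (((p × q) ⊕ Unit) ⊕ (p ⊕ q)) :=
    Finset.univ.map ⟨Sum.inr, Sum.inr_injective⟩ with hT
  have hcard : T.card = Fintype.card p + Fintype.card q := by simp [hT]
  have hTne : T.Nonempty := by
    rw [← Finset.card_pos, hcard]
    have := Fintype.card_pos (α := p)
    omega
  have h := measureReal_le_sqrt_sum_sq_le T hTne (c := √2 * c) (by positivity)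
  rw [mul_pow, Real.sq_sqrt (by norm_num), show -(2 * c ^ 2) / 2 = -c ^ 2 by ring] at h
  refine le_trans (measureReal_mono fun ξ hξ => ?_) h
  obtain ⟨i, hi⟩ := hξ
  have h1 : ∑ k, sumCoeff (u i) (v i) k * ξ k = ∑ k ∈ T, sumCoeff (u i) (v i) k * ξ k := by
    rw [Fintype.sum_sum_type, hT, Finset.sum_map]
    simp [sumCoeff]
  have h2 : ∑ k ∈ T, sumCoeff (u i) (v i) k ^ 2 = 2 := by
    rw [hT, Finset.sum_map]
    simp [sumCoeff, hu, hv]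
    norm_num
  have h3 := Real.sum_mul_le_sqrt_mul_sqrt T (sumCoeff (u i) (v i)) ξ
  rw [h2, ← h1] at h3
  have h4 : √(T.card : ℝ) ≤ √2 * √(Fintype.card p : ℝ) := by
    rw [← Real.sqrt_mul (by norm_num), hcard]
    refine Real.sqrt_le_sqrt ?_
    push_cast
    have : (Fintype.card q : ℝ) ≤ Fintype.card p := by exact_mod_cast hpq
    linarith
  have h5 : (√2 : ℝ) * √2 = 2 := Real.mul_self_sqrt (by norm_num)
  have h6 : √2 * (√2 * √(Fintype.card p : ℝ) + √2 * c) ≤ √2 * √(∑ k ∈ T, ξ k ^ 2) := by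
    calc √2 * (√2 * √(Fintype.card p : ℝ) + √2 * c)
        = (√2 * √2) * √(Fintype.card p : ℝ) + (√2 * √2) * c := by ring
      _ ≤ _ := by rw [h5]; exact hi.le.trans h3
  have h7 := le_of_mul_le_mul_left h6 (by positivity)
  simp only [Set.mem_ofPred_eq]
  linarith

theorem measureReal_exists_prodCoeff_le {I : Type*} [Fintype I]
    (hpq : Fintype.card q ≤ Fintype.card p)
    [Nonempty p] (u : I → p → ℝ) (v : I → q → ℝ) (hu : ∀ i, ∑ r, u i r ^ 2 = 1)
    (hv : ∀ i, ∑ s, v i s ^ 2 = 1) {c c' : ℝ} (hc : 0 ≤ c') (hcc : c' < c) {e : ℝ}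
    (he : e * e = 1) :
    (stdPi (((p × q) ⊕ Unit) ⊕ (p ⊕ q))).real
      {ξ | ∃ i, 2 * √(Fintype.card p : ℝ) + 2 * c ≤ ∑ k, prodCoeff e (u i) (v i) k * ξ k} ≤
      Real.exp (-c' ^ 2) := by
  have hA : ∀ i j, ∑ k, prodCoeff e (u i) (v i) k * prodCoeff e (u j) (v j) k =
      (∑ r, u i r * u j r) * (∑ s, v i s * v j s) + 1 := by
    intro i j
    simp only [prodCoeff, Fintype.sum_sum_type, Sum.elim_inl, Sum.elim_inr, Fintype.sum_prod_type,
      Finset.sum_mul_sum, mul_zero, Finset.sum_const_zero, add_zero, he]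
    simp only [Finset.univ_unique, Finset.sum_singleton, add_left_inj]
    exact Finset.sum_congr rfl fun r _ => Finset.sum_congr rfl fun s _ => by ring
  have hB : ∀ i j, ∑ k, sumCoeff (u i) (v i) k * sumCoeff (u j) (v j) k =
      (∑ r, u i r * u j r) + ∑ s, v i s * v j s := by
    intro i j
    simp [sumCoeff, Fintype.sum_sum_type]
  have hu' : ∀ i, ∑ r, u i r * u i r = 1 := fun i => by simpa only [sq] using hu i
  have hv' : ∀ i, ∑ r, v i r * v i r = 1 := fun i => by simpa only [sq] using hv i
  have h := measureReal_exists_le_of_covariance_le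
    (fun i => prodCoeff e (u i) (v i)) (fun i => sumCoeff (u i) (v i)) ?_ ?_ ?_
    (2 * √(Fintype.card p : ℝ) + 2 * c') (δ := 2 * (c - c')) (by linarith)
  · rw [show 2 * √(Fintype.card p : ℝ) + 2 * c' + 2 * (c - c') =
      2 * √(Fintype.card p : ℝ) + 2 * c by ring] at h
    exact h.trans (measureReal_exists_sumCoeff_le hpq u v hu hv hc)
  · intro i j
    simp [prodCoeff, sumCoeff, Fintype.sum_sum_type]
  · intro i
    rw [hA, hB, hu', hv']
    norm_num
  · intro i j
    rw [hA, hB]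
    -- With `x = ⟨u,u'⟩` and `y = ⟨v,v'⟩`, the claim `x + y ≤ xy + 1` is `(1 - x)(1 - y) ≥ 0`.
    nlinarith [mul_nonneg (sub_nonneg.2 (sum_mul_le_one (hu i) (hu j)))
      (sub_nonneg.2 (sum_mul_le_one (hv i) (hv j)))]

/-- A tail bound for the bilinear form of a standard Gaussian matrix, over finitely many pairs of
unit vectors. -/
theorem measureReal_exists_bilin_le_of_fintype {I : Type*} [Fintype I]
    (hpq : Fintype.card q ≤ Fintype.card p)
    [Nonempty p] (u : I → p → ℝ) (v : I → q → ℝ) (hu : ∀ i, ∑ r, u i r ^ 2 = 1)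
    (hv : ∀ i, ∑ s, v i s ^ 2 = 1) {c c' : ℝ} (hc : 0 ≤ c') (hcc : c' < c) :
    (stdPi (p × q)).real
      {G | ∃ i, 2 * √(Fintype.card p : ℝ) + 2 * c ≤ ∑ rs, u i rs.1 * v i rs.2 * G rs} ≤
      2 * Real.exp (-c' ^ 2) := by
  have hmp := measurePreserving_precomp_stdPi (K := ((p × q) ⊕ Unit) ⊕ (p ⊕ q))
    (g := fun rs : p × q => Sum.inl (Sum.inl rs)) (Sum.inl_injective.comp Sum.inl_injective)
  have hm : MeasurableSet {G : p × q → ℝ |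
      ∃ i, 2 * √(Fintype.card p : ℝ) + 2 * c ≤ ∑ rs, u i rs.1 * v i rs.2 * G rs} := by
    simp only [Set.ofPred_exists]
    exact MeasurableSet.iUnion fun i => measurableSet_le measurable_const (by fun_prop)
  rw [← hmp.measureReal_preimage hm.nullMeasurableSet, two_mul (Real.exp _)]
  -- One of `γ`, `-γ` is nonnegative, so adding it cannot push the form below the threshold. The
  -- union over both signs costs the factor 2.
  refine le_trans ?_ ((measureReal_union_le _ _).trans (add_le_add
    (measureReal_exists_prodCoeff_le hpq u v hu hv hc hcc (e := 1) (by norm_num))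
    (measureReal_exists_prodCoeff_le hpq u v hu hv hc hcc (e := -1) (by norm_num))))
  refine measureReal_mono fun ξ hξ => ?_
  obtain ⟨i, hi⟩ := hξ
  have hs : ∀ e : ℝ, ∑ k, prodCoeff e (u i) (v i) k * ξ k =
      ∑ rs : p × q, u i rs.1 * v i rs.2 * ξ (Sum.inl (Sum.inl rs)) +
        e * ξ (Sum.inl (Sum.inr ())) := fun e => by
    simp [prodCoeff, Fintype.sum_sum_type]
  rcases le_total 0 (ξ (Sum.inl (Sum.inr ()))) with h0 | h0
  · exact Or.inl ⟨i, by rw [hs]; linarith⟩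
  · exact Or.inr ⟨i, by rw [hs]; linarith⟩

/-- Continuity from below along finite subsets: the bound does not depend on the number of pairs. -/
theorem measureReal_exists_bilin_le {ι : Type*} [Countable ι]
    (hpq : Fintype.card q ≤ Fintype.card p)
    [Nonempty p] (u : ι → p → ℝ) (v : ι → q → ℝ) (hu : ∀ i, ∑ r, u i r ^ 2 = 1)
    (hv : ∀ i, ∑ s, v i s ^ 2 = 1) {c c' : ℝ} (hc : 0 ≤ c') (hcc : c' < c) :
    (stdPi (p × q)).real
      {G | ∃ i, 2 * √(Fintype.card p : ℝ) + 2 * c ≤ ∑ rs, u i rs.1 * v i rs.2 * G rs} ≤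
      2 * Real.exp (-c' ^ 2) := by
  classical
  set A : ι → Set (p × q → ℝ) := fun i =>
    {G | 2 * √(Fintype.card p : ℝ) + 2 * c ≤ ∑ rs, u i rs.1 * v i rs.2 * G rs} with hA
  have hU : {G : p × q → ℝ | ∃ i, 2 * √(Fintype.card p : ℝ) + 2 * c ≤
      ∑ rs, u i rs.1 * v i rs.2 * G rs} = ⋃ S : Finset ι, ⋃ i ∈ S, A i := by
    ext G
    simp only [hA, Set.mem_ofPred_eq, Set.mem_iUnion, exists_prop]
    exact ⟨fun ⟨i, hi⟩ => ⟨{i}, i, by simp, hi⟩, fun ⟨_, i, _, hi⟩ => ⟨i, hi⟩⟩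
  have hmono : Monotone fun S : Finset ι => ⋃ i ∈ S, A i :=
    fun S T hST => Set.biUnion_subset_biUnion_left hST
  rw [hU, measureReal_def, hmono.directed_le.measure_iUnion]
  refine ENNReal.toReal_le_of_le_ofReal (by positivity) (iSup_le fun S => ?_)
  rw [← ENNReal.ofReal_toReal (measure_ne_top (stdPi (p × q)) (⋃ i ∈ S, A i))]
  refine ENNReal.ofReal_le_ofReal ?_
  have h := measureReal_exists_bilin_le_of_fintype hpq (fun i : S => u i) (fun i : S => v i)
    (fun i => hu i) (fun i => hv i) hc hcc
  refine le_trans (measureReal_mono fun G hG => ?_) h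
  simp only [Set.mem_iUnion, exists_prop] at hG
  obtain ⟨i, hi, hG⟩ := hG
  exact ⟨⟨i, hi⟩, hG⟩

theorem sum_sq_of_mem_sphere {r : Type*} [Fintype r]
    (x : Metric.sphere (0 : EuclideanSpace ℝ r) 1) : ∑ i, (x : EuclideanSpace ℝ r) i ^ 2 = 1 := by
  rw [← EuclideanSpace.real_norm_sq_eq, mem_sphere_zero_iff_norm.1 x.2, one_pow]

theorem toLp_div_mem_sphere {r : Type*} [Fintype r] (x : r → ℝ) {X : ℝ} (hX : X ≠ 0)
    (hX2 : X ^ 2 = ∑ i, x i ^ 2) :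
    WithLp.toLp 2 (fun i => x i / X) ∈ Metric.sphere (0 : EuclideanSpace ℝ r) 1 := by
  rw [mem_sphere_zero_iff_norm, EuclideanSpace.norm_eq, Real.sqrt_eq_one]
  simp only [Real.norm_eq_abs, sq_abs, div_pow, ← Finset.sum_div, ← hX2]
  exact div_self (pow_ne_zero 2 hX)

/-- A tail bound for the operator norm of a standard Gaussian matrix. -/
theorem measureReal_opNorm_gt_le (hpq : Fintype.card q ≤ Fintype.card p) [Nonempty p]
    {c c' : ℝ} (hc : 0 ≤ c') (hcc : c' < c) :
    (stdPi (p × q)).real {G | ¬ ∀ x : p → ℝ, ∑ s, (∑ r, x r * G (r, s)) ^ 2 ≤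
        (2 * √(Fintype.card p : ℝ) + 2 * c) ^ 2 * ∑ r, x r ^ 2} ≤ 2 * Real.exp (-c' ^ 2) := by
  set M := 2 * √(Fintype.card p : ℝ) + 2 * c with hM
  have hM0 : 0 ≤ M := by rw [hM]; have := hc.trans hcc.le; positivity
  -- A countable dense set of pairs suffices, since the bilinear form is continuous on the spheres.
  -- The operator bound then follows by testing on `x` and `y = Gᵀx`, normalized.
  obtain ⟨D, hDc, hDd⟩ := TopologicalSpace.exists_countable_dense
    (Metric.sphere (0 : EuclideanSpace ℝ p) 1 × Metric.sphere (0 : EuclideanSpace ℝ q) 1)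
  have : Countable D := hDc.to_subtype
  refine le_trans (measureReal_mono fun G hG => ?_) (measureReal_exists_bilin_le hpq
    (fun i : D => (i.1.1 : EuclideanSpace ℝ p)) (fun i : D => (i.1.2 : EuclideanSpace ℝ q))
    (fun i => sum_sq_of_mem_sphere _) (fun i => sum_sq_of_mem_sphere _) hc hcc)
  by_contra hno
  refine hG fun x => ?_
  simp only [Set.mem_ofPred_eq, not_exists, not_le] at hno
  have hall : ∀ z : Metric.sphere (0 : EuclideanSpace ℝ p) 1 ×
      Metric.sphere (0 : EuclideanSpace ℝ q) 1,
      ∑ rs : p × q, (z.1 : EuclideanSpace ℝ p) rs.1 * (z.2 : EuclideanSpace ℝ q) rs.2 * G rs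
        ≤ M := by
    have hcl : IsClosed {z : Metric.sphere (0 : EuclideanSpace ℝ p) 1 ×
        Metric.sphere (0 : EuclideanSpace ℝ q) 1 |
        ∑ rs : p × q, (z.1 : EuclideanSpace ℝ p) rs.1 * (z.2 : EuclideanSpace ℝ q) rs.2 * G rs
          ≤ M} := isClosed_le (by fun_prop) continuous_const
    intro z
    exact hcl.closure_subset_iff.2 (fun z hz => (hno ⟨z, hz⟩).le) (hDd z)
  set y : q → ℝ := fun s => ∑ r, x r * G (r, s) with hy
  set X := √(∑ r, x r ^ 2) with hX
  set Y := √(∑ s, y s ^ 2) with hY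
  have hX2 : X ^ 2 = ∑ r, x r ^ 2 := Real.sq_sqrt (Finset.sum_nonneg fun _ _ => sq_nonneg _)
  have hY2 : Y ^ 2 = ∑ s, y s ^ 2 := Real.sq_sqrt (Finset.sum_nonneg fun _ _ => sq_nonneg _)
  rw [← hX2, ← hY2, ← mul_pow]
  refine pow_le_pow_left₀ (Real.sqrt_nonneg _) ?_ 2
  change Y ≤ M * X
  by_cases hY0 : Y = 0
  · rw [hY0]; exact mul_nonneg hM0 (Real.sqrt_nonneg _)
  by_cases hX0 : X = 0
  · exfalso
    have hx0 : ∀ r, x r = 0 := by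
      rw [hX0] at hX2
      have := (Finset.sum_eq_zero_iff_of_nonneg fun r _ => sq_nonneg (x r)).1
        (by rw [← hX2]; norm_num)
      exact fun r => pow_eq_zero_iff (by norm_num) |>.1 (this r (Finset.mem_univ r))
    apply hY0
    have hy0 : ∀ s, y s = 0 := fun s => by simp [hy, hx0]
    simp [hY, hy0]
  have h := hall (⟨_, toLp_div_mem_sphere x hX0 hX2⟩, ⟨_, toLp_div_mem_sphere y hY0 hY2⟩)
  have hval : ∑ rs : p × q, x rs.1 / X * (y rs.2 / Y) * G rs = Y / X := by
    have h1 : ∀ rs : p × q, x rs.1 / X * (y rs.2 / Y) * G rs =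
        (y rs.2 * (x rs.1 * G (rs.1, rs.2))) / (X * Y) := fun rs => by
      rw [Prod.mk.eta]; field_simp
    simp only [h1]
    rw [← Finset.sum_div, Fintype.sum_prod_type_right]
    simp only [← Finset.mul_sum]
    have h2 : ∑ s, y s * ∑ r, x r * G (r, s) = Y ^ 2 := by
      rw [hY2]; exact Finset.sum_congr rfl fun s _ => by rw [sq]
    rw [h2]
    field_simp
  have h' : Y / X ≤ M := by rw [← hval]; exact h
  rwa [div_le_iff₀ (lt_of_le_of_ne (Real.sqrt_nonneg _) (Ne.symm hX0))] at h'

end OperatorNorm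

/-! ### Singular values, pseudoinverse rows and the deviation of `ζ`. -/

section Pseudoinverse

variable {𝕜 : Type*} [RCLike 𝕜]

/-- The smallest singular value bounds a linear map from below. -/
theorem singularValues_mul_norm_le {E F : Type*} [NormedAddCommGroup E] [InnerProductSpace 𝕜 E]
    [FiniteDimensional 𝕜 E] [NormedAddCommGroup F] [InnerProductSpace 𝕜 F] [FiniteDimensional 𝕜 F]
    (T : E →ₗ[𝕜] F) {n : ℕ} (hn : Module.finrank 𝕜 E = n) (x : E) :
    T.singularValues (n - 1) * ‖x‖ ≤ ‖T x‖ := by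
  have hT := T.isSymmetric_adjoint_comp_self
  set b := hT.eigenvectorBasis hn with hb
  refine le_of_sq_le_sq ?_ (norm_nonneg _)
  have h1 : ‖T x‖ ^ 2 = ∑ i, hT.eigenvalues hn i * ‖b.repr x i‖ ^ 2 := by
    have h2 : ((‖T x‖ ^ 2 : ℝ) : 𝕜) = inner 𝕜 x ((LinearMap.adjoint T ∘ₗ T) x) := by
      rw [LinearMap.comp_apply, LinearMap.adjoint_inner_right, inner_self_eq_norm_sq_to_K]
      push_cast
      rfl
    rw [← b.repr.inner_map_map, PiLp.inner_apply] at h2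
    simp only [hb, hT.eigenvectorBasis_apply_self_apply, RCLike.inner_apply] at h2
    have h3 : ((‖T x‖ ^ 2 : ℝ) : 𝕜) =
        ((∑ i, hT.eigenvalues hn i * ‖b.repr x i‖ ^ 2 : ℝ) : 𝕜) := by
      rw [h2]
      push_cast
      refine Finset.sum_congr rfl fun i _ => ?_
      rw [mul_assoc, RCLike.mul_conj]
    exact_mod_cast h3
  rw [h1, mul_pow, ← b.repr.norm_map x, EuclideanSpace.norm_sq_eq, Finset.mul_sum]
  -- Every index is at most `n - 1`, where the singular value is smallest; for `n = 0` the sum is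
  -- empty, so the truncated subtraction is harmless.
  refine Finset.sum_le_sum fun i _ => mul_le_mul_of_nonneg_right ?_ (sq_nonneg _)
  rw [← T.sq_singularValues_fin hn i]
  exact pow_le_pow_left₀ (T.singularValues_nonneg _)
    (T.singularValues_antitone (by have := i.2; omega)) 2

section Pinv

variable {p q : Type*} [Fintype p] [Fintype q]
  {A : Matrix p q 𝕜} {B : Matrix q p 𝕜}

theorem toEuclideanLin_mul_apply [DecidableEq p] [DecidableEq q] (M : Matrix p q 𝕜)
    (N : Matrix q p 𝕜) (y : EuclideanSpace 𝕜 p) :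
    Matrix.toEuclideanLin (M * N) y = Matrix.toEuclideanLin M (Matrix.toEuclideanLin N y) := by
  simp [Matrix.toLpLin_apply, Matrix.mulVec_mulVec]

/-- `A * B` is Hermitian and idempotent, an orthogonal projection, hence a contraction; `hs` is
applied at `B y`. -/
theorem IsMoorePenrose.mul_norm_le [DecidableEq p] [DecidableEq q] (h : IsMoorePenrose A B) {s : ℝ}
    (hs : ∀ x, s * ‖x‖ ≤ ‖Matrix.toEuclideanLin A x‖) (y : EuclideanSpace 𝕜 p) :
    s * ‖Matrix.toEuclideanLin B y‖ ≤ ‖y‖ := by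
  refine (hs _).trans ?_
  rw [← toEuclideanLin_mul_apply]
  have hsym := Matrix.isSymmetric_toEuclideanLin_iff.2 h.isHermitian_left
  set P := Matrix.toEuclideanLin (A * B) with hP
  have hPP : P (P y) = P y := by
    simp only [hP, Matrix.toLpLin_apply, Matrix.mulVec_mulVec]
    rw [← Matrix.mul_assoc (A * B) A B, h.mul_mul_left]
  have h1 : ‖P y‖ * ‖P y‖ ≤ ‖y‖ * ‖P y‖ := by
    rw [← inner_self_eq_norm_mul_norm (𝕜 := 𝕜), hsym y (P y), hPP]
    exact (RCLike.re_le_norm _).trans (norm_inner_le_norm _ _)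
  rcases eq_or_lt_of_le (norm_nonneg (P y)) with h0 | h0
  · rw [← h0]; exact norm_nonneg _
  · exact le_of_mul_le_mul_right h1 h0

/-- `A` is injective by `hs`, and `A * B * A = A` cancels to the claim. -/
theorem IsMoorePenrose.mul_eq_one [DecidableEq q] (h : IsMoorePenrose A B) {s : ℝ} (hs0 : 0 < s)
    (hs : ∀ x, s * ‖x‖ ≤ ‖Matrix.toEuclideanLin A x‖) : B * A = 1 := by
  apply (Matrix.toEuclideanLin (𝕜 := 𝕜)).injective
  ext1 x
  have h1 := hs (Matrix.toEuclideanLin (B * A) x - x)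
  have h2 : Matrix.toEuclideanLin A (Matrix.toEuclideanLin (B * A) x - x) = 0 := by
    rw [map_sub, sub_eq_zero]
    simp only [Matrix.toLpLin_apply, Matrix.mulVec_mulVec]
    rw [← Matrix.mul_assoc, h.mul_mul_left]
  rw [h2, norm_zero] at h1
  have h3 : ‖Matrix.toEuclideanLin (B * A) x - x‖ = 0 :=
    le_antisymm (nonpos_of_mul_nonpos_right h1 hs0) (norm_nonneg _)
  rw [norm_eq_zero, sub_eq_zero] at h3
  rw [h3]
  simp

/-- Test `hB` on the conjugate of row `j`: coordinate `j` of the image is the squared norm of that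
row. -/
theorem mul_norm_row_le_one [DecidableEq p] {s : ℝ} (hs0 : 0 ≤ s)
    (hB : ∀ y, s * ‖Matrix.toEuclideanLin B y‖ ≤ ‖y‖) (j : q) :
    s * ‖(WithLp.toLp 2 (B j) : EuclideanSpace 𝕜 p)‖ ≤ 1 := by
  set r : EuclideanSpace 𝕜 p := WithLp.toLp 2 (B j) with hr
  set y : EuclideanSpace 𝕜 p := WithLp.toLp 2 (star (B j)) with hy
  have hny : ‖y‖ = ‖r‖ := by simp [EuclideanSpace.norm_eq, hr, hy]
  have h1 : (Matrix.toEuclideanLin B y) j = ((‖r‖ ^ 2 : ℝ) : 𝕜) := by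
    rw [EuclideanSpace.norm_sq_eq]
    simp [Matrix.toLpLin_apply, Matrix.mulVec, dotProduct, hy, hr, RCLike.mul_conj]
  have h2 : ‖r‖ ^ 2 ≤ ‖Matrix.toEuclideanLin B y‖ := by
    have := PiLp.norm_apply_le (Matrix.toEuclideanLin B y) j
    rwa [h1, RCLike.norm_of_nonneg (sq_nonneg _)] at this
  have h3 : s * ‖r‖ * ‖r‖ ≤ 1 * ‖r‖ := by
    rw [one_mul, mul_assoc, ← sq, ← hny]
    rw [← hny] at h2
    exact (mul_le_mul_of_nonneg_left h2 hs0).trans (hB y)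
  rcases eq_or_lt_of_le (norm_nonneg r) with h0 | h0
  · rw [← h0, mul_zero]; exact zero_le_one
  · exact le_of_mul_le_mul_right h3 h0

end Pinv

/-- The operator norm of a real matrix bounds its action on row vectors over `𝕜`. -/
theorem norm_vecMul_ofReal_le {p : Type*} [Fintype p] {l : ℕ} {W : Matrix p (Fin l) ℝ} {N : ℝ}
    (hN : 0 ≤ N)
    (hW : ∀ x : p → ℝ, ∑ s, (∑ r, x r * W r s) ^ 2 ≤ N ^ 2 * ∑ r, x r ^ 2) (b : p → 𝕜) :
    ‖(WithLp.toLp 2 (b ᵥ* W.map (fun x => (x : 𝕜))) : EuclideanSpace 𝕜 (Fin l))‖ ≤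
      N * ‖(WithLp.toLp 2 b : EuclideanSpace 𝕜 p)‖ := by
  refine le_of_sq_le_sq ?_ (by positivity)
  rw [mul_pow, EuclideanSpace.norm_sq_eq, EuclideanSpace.norm_sq_eq]
  simp only [RCLike.norm_sq_eq_def, Matrix.vecMul, dotProduct, Matrix.map_apply, map_sum,
    RCLike.re_mul_ofReal, RCLike.im_mul_ofReal, Finset.sum_add_distrib, mul_add, ← sq]
  -- As `W` is real, it acts separately on the real and imaginary parts of `b`.
  exact add_le_add (hW _) (hW _)

variable {m n l : ℕ}

theorem sigmaMin_mul_norm_le (Φ : Matrix (Fin m) (Fin n) 𝕜) (J : Finset (Fin n))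
    (x : EuclideanSpace 𝕜 J) : sigmaMin Φ J * ‖x‖ ≤ ‖Matrix.toEuclideanLin (colSub Φ J) x‖ :=
  singularValues_mul_norm_le _ (by simp) x

theorem mul_eq_colSub_mul (Φ : Matrix (Fin m) (Fin n) 𝕜) {X : Matrix (Fin n) (Fin l) 𝕜}
    {J : Finset (Fin n)} (hJ : rowSupport X ⊆ J) :
    Φ * X = colSub Φ J * X.submatrix (Subtype.val : J → Fin n) id := by
  ext i k
  simp only [Matrix.mul_apply, colSub, Matrix.submatrix_apply, id]
  rw [Finset.sum_coe_sort J fun j => Φ i j * X j k]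
  refine (Finset.sum_subset (Finset.subset_univ J) fun j _ hj => ?_).symm
  have : X j = 0 := by
    by_contra h
    exact hj (hJ (by simp [rowSupport, h]))
  simp [this]

/-- The deviation of the rows of `Φ_J† Y` from those of the signal matrix. -/
theorem abs_zeta_sub_rowNorm_mul_le (Φ : Matrix (Fin m) (Fin n) 𝕜) (X : Matrix (Fin n) (Fin l) 𝕜)
    (W : Matrix (Fin m) (Fin l) ℝ) {J : Finset (Fin n)} (hJ : rowSupport X ⊆ J)
    (hs : 0 < sigmaMin Φ J) {N : ℝ} (hN : 0 ≤ N)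
    (hW : ∀ x : Fin m → ℝ, ∑ s, (∑ r, x r * W r s) ^ 2 ≤ N ^ 2 * ∑ r, x r ^ 2) (j : J) :
    |zeta Φ (measurement Φ X W) J j - rowNorm X j| * sigmaMin Φ J ≤ N := by
  have hP := pinv_spec (colSub Φ J)
  set B := pinv (colSub Φ J) with hB
  have h1 := hP.mul_eq_one hs (sigmaMin_mul_norm_le Φ J)
  have hrow := mul_norm_row_le_one hs.le (hP.mul_norm_le (sigmaMin_mul_norm_le Φ J)) j
  have hmul : B * measurement Φ X W = X.submatrix (Subtype.val : J → Fin n) id +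
      B * W.map (fun x => (x : 𝕜)) := by
    rw [measurement, mul_eq_colSub_mul Φ hJ, Matrix.mul_add, ← Matrix.mul_assoc, h1, Matrix.one_mul]
  have h2 : |zeta Φ (measurement Φ X W) J j - rowNorm X j| ≤
      ‖(WithLp.toLp 2 ((B j) ᵥ* W.map (fun x => (x : 𝕜))) : EuclideanSpace 𝕜 (Fin l))‖ := by
    rw [zeta, ← hB, hmul, rowNorm, rowNorm]
    refine (abs_norm_sub_norm_le _ _).trans (le_of_eq ?_)
    congr 1
    ext k
    simp [Matrix.mul_apply, Matrix.vecMul, dotProduct]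
  calc _ ≤ N * ‖(WithLp.toLp 2 (B j) : EuclideanSpace 𝕜 (Fin m))‖ * sigmaMin Φ J :=
        mul_le_mul_of_nonneg_right (h2.trans (norm_vecMul_ofReal_le hN hW _)) hs.le
    _ = N * (sigmaMin Φ J * ‖(WithLp.toLp 2 (B j) : EuclideanSpace 𝕜 (Fin m))‖) := by ring
    _ ≤ N * 1 := mul_le_mul_of_nonneg_left hrow hN
    _ = N := mul_one _

end Pseudoinverse

/-! ### From the noise bound to support recovery. -/

section Recovery

/-- The operator norm tail bound for a random matrix with i.i.d. centered Gaussian entries. -/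
theorem measureReal_gaussianMatrix_opNorm_gt_le {m l : ℕ} (hm : 0 < m) (hl : l ≤ m)
    {E : Type*} [MeasurableSpace E] (P : Measure E) [IsProbabilityMeasure P]
    {σ : ℝ≥0} (hσ : 0 < σ) (W : E → Matrix (Fin m) (Fin l) ℝ)
    (hlaw : ∀ i j, HasLaw (fun ω => W ω i j) (gaussianReal 0 (σ ^ 2)) P)
    (hindep : iIndepFun (fun (ij : Fin m × Fin l) ω => W ω ij.1 ij.2) P)
    {c c' : ℝ} (hc : 0 ≤ c') (hcc : c' < c) :
    P.real {ω | ¬ ∀ x : Fin m → ℝ, ∑ s, (∑ r, x r * W ω r s) ^ 2 ≤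
        (σ * (2 * √(m : ℝ) + 2 * c)) ^ 2 * ∑ r, x r ^ 2} ≤ 2 * Real.exp (-c' ^ 2) := by
  have hσ' : (0 : ℝ) < σ := hσ
  have : Nonempty (Fin m) := ⟨⟨0, hm⟩⟩
  set g : E → Fin m × Fin l → ℝ := fun ω ij => W ω ij.1 ij.2 / σ with hg
  have hlaw' : ∀ ij : Fin m × Fin l, HasLaw (fun ω => g ω ij) (gaussianReal 0 1) P := by
    intro ij
    have h := gaussianReal_div_const (hlaw ij.1 ij.2) (σ : ℝ)
    convert h using 2
    · simp
    · ext
      simp [hσ.ne']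
  have hind : iIndepFun (fun (ij : Fin m × Fin l) ω => g ω ij) P :=
    hindep.comp (fun _ x => x / (σ : ℝ)) fun _ => by fun_prop
  have hmap : P.map g = stdPi (Fin m × Fin l) := by
    have h := hind.map_fun_eq_pi_map fun ij => (hlaw' ij).aemeasurable
    simp only [(hlaw' _).map_eq] at h
    exact h
  have hgm : AEMeasurable g P := aemeasurable_pi_lambda _ fun ij => (hlaw' ij).aemeasurable
  have hb := measureReal_opNorm_gt_le (p := Fin m) (q := Fin l) (by simpa using hl) hc hcc
  rw [Fintype.card_fin, ← hmap] at hb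
  refine le_trans ?_ hb
  refine le_trans (measureReal_mono fun ω hω => ?_)
    -- This inequality for image measures needs no measurability of the set.
    (ENNReal.toReal_mono (measure_ne_top _ _) (Measure.le_map_apply hgm _))
  refine fun h => hω fun x => ?_
  have hx := mul_le_mul_of_nonneg_left (h x) (sq_nonneg (σ : ℝ))
  rw [mul_pow, mul_assoc]
  refine le_trans (le_of_eq ?_) hx
  rw [Finset.mul_sum]
  refine Finset.sum_congr rfl fun s _ => ?_
  rw [← mul_pow, Finset.mul_sum]
  congr 1
  refine Finset.sum_congr rfl fun r _ => ?_
  simp only [hg]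
  field_simp

variable {𝕜 : Type*} [RCLike 𝕜] {m n l : ℕ}

theorem SubmpOutput.card_eq {Φ : Matrix (Fin m) (Fin n) 𝕜}
    {S : Submodule 𝕜 (EuclideanSpace 𝕜 (Fin m))} {Γ₀ Γ : Finset (Fin n)} {i : ℕ}
    (h : SubmpOutput Φ S Γ₀ i Γ) : Γ.card = Γ₀.card + i := by
  induction h with
  | zero => rfl
  | succ _ ha _ ih => rw [Finset.card_insert_of_notMem ha, ih, add_assoc]

/-- Distinct sets of equal size each miss an element of the other; the missed support index would
then have `ζ` no larger than an index outside the support. -/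
theorem eq_rowSupport_of_ESMS₁Output {Φ : Matrix (Fin m) (Fin n) 𝕜}
    {X₀ X : Matrix (Fin n) (Fin l) 𝕜} {Y : Matrix (Fin m) (Fin l) 𝕜} {J Q : Finset (Fin n)} {κ : ℝ}
    (hJ : rowSupport X₀ ⊆ J) (hin : ∀ j : J, (j : Fin n) ∈ rowSupport X₀ → κ < zeta Φ Y J j)
    (hout : ∀ j : J, (j : Fin n) ∉ rowSupport X₀ → zeta Φ Y J j < κ)
    (h : ESMS₁Output Φ Y J (rowSupport X₀).card Q X) : Q = rowSupport X₀ := by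
  obtain ⟨hQJ, hcard, hmax, -⟩ := h
  rw [min_eq_left (Finset.card_le_card hJ)] at hcard
  by_contra hne
  have h1 : ¬ rowSupport X₀ ⊆ Q := fun hs => hne (Finset.eq_of_subset_of_card_le hs hcard.le).symm
  have h2 : ¬ Q ⊆ rowSupport X₀ := fun hs => hne (Finset.eq_of_subset_of_card_le hs hcard.ge)
  obtain ⟨b, hb, hbQ⟩ := Finset.not_subset.1 h1
  obtain ⟨a, ha, haX⟩ := Finset.not_subset.1 h2
  have := hmax ⟨a, hQJ ha⟩ ⟨b, hJ hb⟩ ha hbQ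
  linarith [hin ⟨b, hJ hb⟩ hb, hout ⟨a, hQJ ha⟩ haX]

theorem eq_rowSupport_of_ESMS₂Output {Φ : Matrix (Fin m) (Fin n) 𝕜}
    {X₀ X : Matrix (Fin n) (Fin l) 𝕜} {Y : Matrix (Fin m) (Fin l) 𝕜} {J Q : Finset (Fin n)} {κ : ℝ}
    (hJ : rowSupport X₀ ⊆ J) (hin : ∀ j : J, (j : Fin n) ∈ rowSupport X₀ → κ < zeta Φ Y J j)
    (hout : ∀ j : J, (j : Fin n) ∉ rowSupport X₀ → zeta Φ Y J j < κ)
    (h : ESMS₂Output Φ Y J κ Q X) : Q = rowSupport X₀ := by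
  obtain ⟨hQJ, hiff, -⟩ := h
  ext j
  refine ⟨fun hj => ?_, fun hj => (hiff ⟨j, hJ hj⟩).2 (hin _ hj)⟩
  by_contra hjX
  exact lt_asymm ((hiff ⟨j, hQJ hj⟩).1 hj) (hout ⟨j, hQJ hj⟩ hjX)

/-- A bound on the noise that makes the threshold `κ` separate the support. -/
theorem abs_zeta_sub_rowNorm_lt {Φ : Matrix (Fin m) (Fin n) 𝕜} {X₀ : Matrix (Fin n) (Fin l) 𝕜}
    {W : Matrix (Fin m) (Fin l) ℝ} {σ : ℝ≥0} (hσ : 0 < σ) {κ c : ℝ} (hκ : 0 < κ) (hc : 0 < c)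
    {J : Finset (Fin n)} (hJ : rowSupport X₀ ⊆ J) (hcard : J.card + 1 = m) (hne : 0 < J.card)
    (hcJ : c ≤ cConst Φ κ σ J)
    (hW : ∀ x : Fin m → ℝ, ∑ s, (∑ r, x r * W r s) ^ 2 ≤
      (σ * (2 * √(m : ℝ) + 2 * c)) ^ 2 * ∑ r, x r ^ 2) (j : J) :
    |zeta Φ (measurement Φ X₀ W) J j - rowNorm X₀ j| < κ := by
  have hσ' : (0 : ℝ) < σ := hσ
  have hJ0 : 0 < √(J.card : ℝ) := Real.sqrt_pos.2 (by exact_mod_cast hne)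
  -- Strict because `J` is nonempty: the square of the right side is `m + 2√|J|`.
  have hsqrt : √(m : ℝ) < √(J.card : ℝ) + 1 := by
    rw [Real.sqrt_lt' (by positivity), add_sq, Real.sq_sqrt (by positivity), ← hcard]
    push_cast
    linarith
  have hlt : σ * (2 * √(m : ℝ) + 2 * c) < κ * sigmaMin Φ J := by
    have h1 : c + √(J.card : ℝ) + 1 ≤ κ * sigmaMin Φ J / (2 * σ) := by
      rw [cConst] at hcJ; linarith
    rw [le_div_iff₀ (by positivity)] at h1
    have h2 := mul_lt_mul_of_pos_left hsqrt hσ'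
    linarith
  have hN : 0 ≤ σ * (2 * √(m : ℝ) + 2 * c) := by positivity
  -- Full column rank is not assumed: it is forced by the lower bound on `cConst`.
  have hs : 0 < sigmaMin Φ J := pos_of_mul_pos_right (hN.trans_lt hlt) hκ.le
  exact lt_of_mul_lt_mul_right
    ((abs_zeta_sub_rowNorm_mul_le Φ X₀ W hJ hs hN hW j).trans_lt hlt) hs.le

/-- Since `(9/10)² > 1/2`, shrinking `c` to `9c/10` keeps the inequality strict. -/
theorem two_mul_exp_lt {m : ℕ} (hm : 2 ≤ m) {c : ℝ} (hc : 0 < c) :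
    2 * Real.exp (-(9 / 10 * c) ^ 2) < m * Real.exp (-c ^ 2 / 2) := by
  have h1 : Real.exp (-(9 / 10 * c) ^ 2) < Real.exp (-c ^ 2 / 2) :=
    Real.exp_lt_exp.2 (by nlinarith [sq_pos_of_pos hc])
  have h2 : (2 : ℝ) ≤ m := by exact_mod_cast hm
  nlinarith [Real.exp_pos (-c ^ 2 / 2)]

end Recovery

end MMV

theorem mainTheorem9 {𝕜 : Type*} [RCLike 𝕜] {m n l : ℕ} (hm : 0 < m) (hl : l ≤ m)
    {E : Type*} [MeasurableSpace E] (P : Measure E) [IsProbabilityMeasure P]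
    (Φ : Matrix (Fin m) (Fin n) 𝕜) (X₀ : Matrix (Fin n) (Fin l) 𝕜)
    (σ : ℝ≥0) (hσ : 0 < σ) (W : E → Matrix (Fin m) (Fin l) ℝ)
    (hlaw : ∀ i j, HasLaw (fun ω => W ω i j) (gaussianReal 0 (σ ^ 2)) P)
    (hindep : iIndepFun (fun (ij : Fin m × Fin l) ω => W ω ij.1 ij.2) P)
    (κ : ℝ) (hκ : 0 < 2 * κ) (hκX : ∀ a ∈ MMV.rowSupport X₀, 2 * κ ≤ MMV.rowNorm X₀ a)
    (c : ℝ) (hc : 0 < c) :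
    ∃ G : Set E, MeasurableSet G ∧
      1 - (m : ℝ) * Real.exp (-c ^ 2 / 2) < P.real G ∧
      ∀ ω ∈ G, ∀ (est : Matrix (Fin m) (Fin l) 𝕜 → Submodule 𝕜 (EuclideanSpace 𝕜 (Fin m)))
        (Ωc Ωhat : Finset (Fin n)) (Xhat : Matrix (Fin n) (Fin l) 𝕜),
        (MMV.TSMP₁Output est (MMV.rowSupport X₀).card Φ (MMV.measurement Φ X₀ (W ω))
            Ωc Ωhat Xhat ∨
          MMV.TSMP₂Output est κ Φ (MMV.measurement Φ X₀ (W ω)) Ωc Ωhat Xhat) →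
        MMV.rowSupport X₀ ⊆ Ωc → c ≤ MMV.cConst Φ κ σ Ωc →
        Ωhat = MMV.rowSupport X₀ := by
  have hκ' : 0 < κ := by linarith
  rcases Nat.lt_or_ge 1 m with hm2 | hm1
  · set bad : Set E := {ω | ¬ ∀ x : Fin m → ℝ, ∑ s, (∑ r, x r * W ω r s) ^ 2 ≤
        (σ * (2 * √(m : ℝ) + 2 * c)) ^ 2 * ∑ r, x r ^ 2} with hbad
    have hP : P.real bad < m * Real.exp (-c ^ 2 / 2) :=
      (MMV.measureReal_gaussianMatrix_opNorm_gt_le hm hl P hσ W hlaw hindep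
        (c' := 9 / 10 * c) (by positivity) (by linarith)).trans_lt (MMV.two_mul_exp_lt hm2 hc)
    -- `W` is only almost everywhere measurable, so `bad` is replaced by a measurable superset of
    -- equal measure.
    refine ⟨(toMeasurable P bad)ᶜ, (measurableSet_toMeasurable P bad).compl, ?_, ?_⟩
    · rw [probReal_compl_eq_one_sub (measurableSet_toMeasurable P bad), measureReal_def,
        measure_toMeasurable, ← measureReal_def]
      linarith
    · intro ω hω est Ωc Ωhat Xhat hout hsub hcc
      have hW := not_not.1 fun h => hω (subset_toMeasurable P bad h)
      have hcard : Ωc.card + 1 = m := by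
        have : Ωc.card = m - 1 := by
          rcases hout with h | h <;> simpa using h.1.card_eq
        omega
      have hdev := MMV.abs_zeta_sub_rowNorm_lt hσ hκ' hc hsub hcard (by omega) hcc hW
      have hin : ∀ j : Ωc, (j : Fin n) ∈ MMV.rowSupport X₀ →
          κ < MMV.zeta Φ (MMV.measurement Φ X₀ (W ω)) Ωc j := fun j hj => by
        linarith [(abs_lt.1 (hdev j)).1, hκX j hj]
      have hnot : ∀ j : Ωc, (j : Fin n) ∉ MMV.rowSupport X₀ →
          MMV.zeta Φ (MMV.measurement Φ X₀ (W ω)) Ωc j < κ := fun j hj => by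
        have h0 : X₀ j = 0 := by simpa [MMV.rowSupport] using hj
        have h1 := (abs_lt.1 (hdev j)).2
        rw [MMV.rowNorm, h0] at h1
        simpa using h1
      rcases hout with h | h
      · exact MMV.eq_rowSupport_of_ESMS₁Output hsub hin hnot h.2
      · exact MMV.eq_rowSupport_of_ESMS₂Output hsub hin hnot h.2
  -- For `m = 1` the greedy stage makes no step, so `Ωc`, `Ωhat` and the support contained in `Ωc`
  -- are all empty.
  · refine ⟨Set.univ, MeasurableSet.univ, ?_, ?_⟩
    · rw [probReal_univ, sub_lt_self_iff]
      exact mul_pos (by exact_mod_cast hm) (Real.exp_pos _)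
    · intro ω _ est Ωc Ωhat Xhat hout hsub _
      have hΩc : Ωc = ∅ := by
        rw [← Finset.card_eq_zero]
        have : Ωc.card = m - 1 := by
          rcases hout with h | h <;> simpa using h.1.card_eq
        omega
      have hhat : Ωhat ⊆ Ωc := by
        rcases hout with h | h <;> exact h.2.1
      rw [hΩc, Finset.subset_empty] at hhat hsub
      rw [hhat, hsub]
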